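/- Let $G=(V,A)$ be a finite directed graph with a root $r\in V$, and let $0<p_a<1$ be the failure probability of the arc $a\in A$. For $S\subseteq A$, a cluster of $(V,S)$ is a nonempty set $C\subseteq V\setminus\{r\}$ that no arc of $S$ leaves; it is minimal if no proper subset of it is a cluster. To draw an arc $a$ is to make it present with probability $1-p_a$, independently of everything else. Basic cluster-popping: draw all arcs of $A$ to obtain $S$; while $(V,S)$ has a cluster, redraw all arcs $u\to v\in A$ such that $u$ lies in some minimal cluster of $(V,S)$; return $S$. Dynamic-DFS cluster-popping: draw all arcs of $A$ to obtain $R$; set $r.\mathrm{index}=r.\mathrm{root}=1$, the counter $\mathrm{index}=2$, and let the stack consist of $r$, all other indices being undefined; while some $v\in V$ has undefined index, call $\mathrm{DFS}(v)$; return $R$. Here $\mathrm{DFS}(v)$ sets $v.\mathrm{index}$ and $v.\mathrm{root}$ to $\mathrm{index}$, increments $\mathrm{index}$ and pushes $v$; then for each $v\to w\in R$, if $w.\mathrm{index}$ is undefined it calls $\mathrm{DFS}(w)$ and sets $v.\mathrm{root}\leftarrow\min\{v.\mathrm{root},w.\mathrm{root}\}$, and otherwise it sets $v.\mathrm{root}\leftarrow\min\{v.\mathrm{root},w.\mathrm{index}\}$.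 If after that $v.\mathrm{root}=v.\mathrm{index}$, it repeatedly pops a vertex $w$, undefines $w.\mathrm{index}$ and $w.\mathrm{root}$, decrements $\mathrm{index}$ and redraws all arcs of $A$ going out of $w$, until $w=v$ has been popped; then it calls $\mathrm{DFS}(v)$ again. The graph is given by adjacency lists (in any order), and the vertices with undefined index are found by one pass over the vertex list. The running time is the number of elementary steps, each of which inspects or updates a bounded number of memory cells and draws at most one arc; initialisation is included. **Theorem.** (1) For every $G$, $r$ and $(p_a)_{a\in A}$, the two algorithms have the same output distribution: for each $S\subseteq A$, they halt and return $S$ with the same probability. If every vertex of $G$ has a directed path to $r$, both halt with probability $1$. (2) There is a universal constant $K>0$ such that, if $G$ is connected and bi-directed with at least one arc (that is, $u\to v\in A$ implies $v\to u\in A$) and $p_{u\to v}=p_{v\to u}$ for every $u\to v\in A$, then the expected running time of dynamic-DFS cluster-popping is at most $$K\left(m+\frac{p_{\max}\,m\,n}{1-p_{\max}}\right),\qquad n=|V|,\ m=|A|,\ p_{\max}=\max_{a\in A}p_a.$$ -/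

import Mathlib

open Finset
open scoped ENNReal

/-! ### Randomised loops: output law and expected number of steps -/

/-- A randomised procedure that repeats one random step. From a state of type `σ` a step either
moves on to a new state (`Sum.inl`) or halts and returns a value (`Sum.inr`). The random choices
of different steps are independent. -/
structure RandomLoop (σ β : Type*) where
  init : PMF σ
  step : σ → PMF (σ ⊕ β)

namespace RandomLoop

variable {σ β : Type*}

/-- The law of the situation after `t` steps: the current state, or the value already returned. -/
noncomputable def run (M : RandomLoop σ β) : ℕ → PMF (σ ⊕ β)
  | 0 => M.init.map Sum.inl
  | t + 1 => (M.run t).bind (Sum.elim M.step fun b => PMF.pure (Sum.inr b))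

/-- The output law: `M.outputLaw b` is the probability that `M` halts and returns `b`, i.e. the
(monotone) limit of the probabilities that it has done so within `t` steps. The missing mass is
the probability that `M` never halts. -/
noncomputable def outputLaw (M : RandomLoop σ β) (b : β) : ℝ≥0∞ :=
  ⨆ t, M.run t (Sum.inr b)

/-- The expected number of steps executed, `∑ t, Pr (M has not halted before step t)`; it is `∞`
if `M` fails to halt with positive probability. -/
noncomputable def expectedSteps (M : RandomLoop σ β) : ℝ≥0∞ :=
  ∑' t, ∑' s, M.run t (Sum.inl s)

end RandomLoop

/-! ### Random arcs and clusters

A directed graph on `V` is given by its finite set of arcs `A`, the arc `u → v` being `(u, v)`.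
The failure probability of the arc `a` is `p a`. -/

section Clusters

variable {V : Type*} [DecidableEq V]

theorem drawArcs_sum_eq_one (p : V × V → Set.Ioo (0 : ℝ) 1) (D : Finset (V × V)) :
    (∑ T ∈ D.powerset, if T ⊆ D then (∏ a ∈ T, ENNReal.ofReal (1 - (p a : ℝ))) *
      ∏ a ∈ D \ T, ENNReal.ofReal (p a : ℝ) else 0) = 1 := by
  have h : (∑ T ∈ D.powerset, if T ⊆ D then (∏ a ∈ T, ENNReal.ofReal (1 - (p a : ℝ))) *
      ∏ a ∈ D \ T, ENNReal.ofReal (p a : ℝ) else 0) =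
      ∏ a ∈ D, (ENNReal.ofReal (1 - (p a : ℝ)) + ENNReal.ofReal (p a : ℝ)) := by
    rw [Finset.prod_add]
    exact Finset.sum_congr rfl fun T hT => if_pos (Finset.mem_powerset.1 hT)
  rw [h]
  refine Finset.prod_eq_one fun a _ => ?_
  rw [← ENNReal.ofReal_add (by linarith [(p a).2.2]) (p a).2.1.le]
  simp

/-- The random subset of `D` that contains each arc `a ∈ D` independently with probability
`1 - p a`. -/
noncomputable def drawArcs (p : V × V → Set.Ioo (0 : ℝ) 1) (D : Finset (V × V)) :
    PMF (Finset (V × V)) :=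
  PMF.ofFinset
    (fun T => if T ⊆ D then (∏ a ∈ T, ENNReal.ofReal (1 - (p a : ℝ))) *
      ∏ a ∈ D \ T, ENNReal.ofReal (p a : ℝ) else 0)
    D.powerset (drawArcs_sum_eq_one p D)
    (fun _ hT => if_neg fun h => hT (Finset.mem_powerset.2 h))

/-- Re-randomise the arcs in `D`, and keep `S` unchanged outside `D`. -/
noncomputable def resample (p : V × V → Set.Ioo (0 : ℝ) 1) (D S : Finset (V × V)) :
    PMF (Finset (V × V)) :=
  (drawArcs p D).map fun T => (S \ D) ∪ T

/-- `C` is a cluster of `(V, S)` with root `r`: a nonempty set of vertices that does not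
contain `r` and that no arc of `S` leaves. -/
def IsCluster (r : V) (S : Finset (V × V)) (C : Finset V) : Prop :=
  C.Nonempty ∧ r ∉ C ∧ ∀ u v, (u, v) ∈ S → u ∈ C → v ∈ C

/-- `C` is a minimal cluster: a cluster no proper subset of which is one. -/
def IsMinimalCluster (r : V) (S : Finset (V × V)) (C : Finset V) : Prop :=
  Minimal (IsCluster r S) C

/-- `(V, S)` is root-connected: every vertex has a directed path to `r`. -/
def RootConnected (r : V) (S : Finset (V × V)) : Prop :=
  ∀ v, Relation.ReflTransGen (fun x y => (x, y) ∈ S) v r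

open Classical in
/-- The arcs of `A` whose tail lies in some minimal cluster of `(V, S)`. -/
noncomputable def poppedArcs (A : Finset (V × V)) (r : V) (S : Finset (V × V)) :
    Finset (V × V) :=
  A.filter fun a => ∃ C, IsMinimalCluster r S C ∧ a.1 ∈ C

open Classical in
/-- Basic cluster-popping. Draw a random set of arcs `S`; as long as `(V, S)` has a cluster,
re-randomise all arcs going out of the vertices of all minimal clusters; return `S`.
One step is one iteration of the while loop. -/
noncomputable def clusterPopping (A : Finset (V × V)) (r : V)
    (p : V × V → Set.Ioo (0 : ℝ) 1) : RandomLoop (Finset (V × V)) (Finset (V × V)) where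
  init := drawArcs p A
  step S :=
    if ∃ C, IsCluster r S C then (resample p (poppedArcs A r S) S).map Sum.inl
    else PMF.pure (Sum.inr S)

/-! ### The dynamic depth-first search -/

/-- An adjacency-list representation of the directed graph `(V, A)`, in arbitrary order. -/
structure AdjacencyList (A : Finset (V × V)) where
  verts : List V
  verts_nodup : verts.Nodup
  mem_verts : ∀ v, v ∈ verts
  out : V → List V
  out_nodup : ∀ v, (out v).Nodup
  mem_out : ∀ v w, w ∈ out v ↔ (v, w) ∈ A

/-- The pending pieces of code of the dynamic depth-first search. -/
inductive DFSTask (V : Type*)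
  /-- For each listed vertex `v`: undefine `v.index` and `v.root`, and draw the arcs out of `v`. -/
  | init (vs : List V)
  /-- `r.index ← 1`, `r.root ← 1`, `index ← 2`, and let the vertex stack consist of `r` only. -/
  | setRoot
  /-- The main loop: a single pass over the listed vertices, which calls the search at each vertex
  found with undefined index. -/
  | main (vs : List V)
  /-- `Dynamic-DFS(v)`. -/
  | dfs (v : V)
  /-- What remains of the loop "for each `v → w ∈ R`" of `Dynamic-DFS(v)`; the out-neighbours `ws`
  of `v` in the input graph are still to be examined. When none is left, test whether
  `v.root = v.index`. -/
  | scan (v : V) (ws : List V)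
  /-- `v.root ← min {v.root, w.root}`. -/
  | join (v w : V)
  /-- Repeat: pop a vertex `w`, undefine its index and root, decrease `index`, and resample the arcs
  out of `w`; until `w = v`. -/
  | pop (v : V)
  /-- Redraw the arcs from `w` to the listed vertices. -/
  | redraw (w : V) (ws : List V)

/-- The memory of the dynamic depth-first search. `none` means UNDEFINED. -/
structure DFSState (V : Type*) where
  /-- the current set of arcs `R` -/
  R : Finset (V × V)
  /-- `v.index` -/
  index : V → Option ℕ
  /-- `v.root` -/
  root : V → Option ℕ
  /-- the global counter `index` -/
  next : ℕ
  /-- the stack of vertices, top first -/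
  stack : List V
  /-- the pending tasks (the recursion stack), next one first -/
  tasks : List (DFSTask V)

/-- One elementary step of the dynamic depth-first search. Each step inspects or updates a bounded
number of memory cells, and draws at most one arc. -/
noncomputable def dfsStep {A : Finset (V × V)} (L : AdjacencyList A) (r : V)
    (p : V × V → Set.Ioo (0 : ℝ) 1) (c : DFSState V) : PMF (DFSState V ⊕ Finset (V × V)) :=
  match c.tasks with
  | [] => PMF.pure (Sum.inr c.R)
  | DFSTask.init [] :: K => PMF.pure (Sum.inl { c with tasks := K })
  | DFSTask.init (v :: vs) :: K => PMF.pure (Sum.inl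
      { c with
        index := Function.update c.index v none
        root := Function.update c.root v none
        tasks := DFSTask.redraw v (L.out v) :: DFSTask.init vs :: K })
  | DFSTask.setRoot :: K => PMF.pure (Sum.inl
      { c with
        index := Function.update c.index r (some 1)
        root := Function.update c.root r (some 1)
        next := 2
        stack := [r]
        tasks := K })
  | DFSTask.main [] :: K => PMF.pure (Sum.inl { c with tasks := K })
  | DFSTask.main (v :: vs) :: K => PMF.pure (Sum.inl
      { c with
        tasks :=
          if c.index v = none then DFSTask.dfs v :: DFSTask.main (v :: vs) :: K
          else DFSTask.main vs :: K })
  | DFSTask.dfs v :: K => PMF.pure (Sum.inl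
      { c with
        index := Function.update c.index v (some c.next)
        root := Function.update c.root v (some c.next)
        next := c.next + 1
        stack := v :: c.stack
        tasks := DFSTask.scan v (L.out v) :: K })
  | DFSTask.scan v [] :: K => PMF.pure (Sum.inl
      { c with
        tasks := if c.root v = c.index v then DFSTask.pop v :: DFSTask.dfs v :: K else K })
  | DFSTask.scan v (w :: ws) :: K => PMF.pure (Sum.inl
      (if (v, w) ∈ c.R then
        if c.index w = none then
          { c with tasks := DFSTask.dfs w :: DFSTask.join v w :: DFSTask.scan v ws :: K }
        else
          { c with
            root := Function.update c.root v (Option.map₂ min (c.root v) (c.index w))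
            tasks := DFSTask.scan v ws :: K }
      else { c with tasks := DFSTask.scan v ws :: K }))
  | DFSTask.join v w :: K => PMF.pure (Sum.inl
      { c with
        root := Function.update c.root v (Option.map₂ min (c.root v) (c.root w))
        tasks := K })
  | DFSTask.pop v :: K =>
      match c.stack with
      | [] => PMF.pure (Sum.inl { c with tasks := K })
      | w :: s => PMF.pure (Sum.inl
          { c with
            index := Function.update c.index w none
            root := Function.update c.root w none
            next := c.next - 1
            stack := s
            tasks := DFSTask.redraw w (L.out w) :: if w = v then K else DFSTask.pop v :: K })
  | DFSTask.redraw _ [] :: K => PMF.pure (Sum.inl { c with tasks := K })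
  | DFSTask.redraw w (x :: xs) :: K =>
      (resample p {(w, x)} c.R).map fun R' =>
        Sum.inl { c with R := R', tasks := DFSTask.redraw w xs :: K }

/-- Cluster-popping by dynamic depth-first search. Its running time is the number of elementary
steps, including the initialisation of the memory and the initial draw of all arcs. -/
noncomputable def dynamicDFS {A : Finset (V × V)} (L : AdjacencyList A) (r : V)
    (p : V × V → Set.Ioo (0 : ℝ) 1) : RandomLoop (DFSState V) (Finset (V × V)) where
  init := PMF.pure
    { R := ∅
      index := fun _ => none
      root := fun _ => none
      next := 1
      stack := []
      tasks := [DFSTask.init L.verts, DFSTask.setRoot, DFSTask.main L.verts] }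
  step := dfsStep L r p

end Clusters

/-! ### Expectations, and drift arguments for random loops. -/

section Expectation

variable {α β : Type*}

/-! Both procedures are compared with popping one minimal cluster at a time. Distinct minimal
clusters are disjoint, and whether a set is a minimal cluster depends only on the arcs out of it. So
popping one leaves the others in place, and the two resamplings commute. By this diamond property
neither the law of the output nor the mean cost of the halting runs depends on the order of the pops
(`popValue_succ`, `popCost_succ`).

Basic cluster-popping performs several such pops at once. The search performs them one by one: by
the low-link invariant `Explored`, a vertex that ends as its own root forms a minimal cluster with
the vertices above it on the stack (`Explored.isMinimalCluster`). Hence the mean of `popLimit` after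
the draws still pending is preserved by every step of either procedure, and both output laws equal
the same expression. If some vertex of the input graph has no path to the root, that expression is
zero.

The freedom of order also bounds the cost. Fix `C₀` and pop it only when nothing else can be popped.
Restricted to a given first pop, the law after it is a multiple of the initial law restricted to
certain sets, disjoint from the popped one, not being minimal clusters; later pops preserve this
form. Under each of these restricted laws halting at once has the weight of root-connectedness, and
popping `C₀` at once has at most the weight of `C₀` being the only minimal cluster. So the mean
number of pops of `C₀` is at most the ratio of these two probabilities
(`resampleExp_popLimitCost_le`).

On a connected symmetric graph the ratio is controlled by a weighted injection. If `S` has a unique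
minimal cluster, take an arc `u → u'` of the input graph from a vertex that does not reach the root
to one that does, reverse all arcs of `S` among the vertices reachable from `u`, and add `u → u'`.
The result is root-connected, reversal preserves the probability, and the new arc costs at most the
odds of failure. The map can be undone from `u` and a vertex of the cluster (`IsRepair.injective`);
recording `u` and an arc out of the cluster gives the factors `n` and `m`
(`sum_card_outArcs_mul_le`). A potential function charges all steps of the search to the
initialisation or to the arcs out of popped clusters (`dynamicDFS_expectedSteps_le`). -/

/-- The expectation of `f` under `q`. -/
noncomputable def PMF.expect (q : PMF α) (f : α → ℝ≥0∞) : ℝ≥0∞ := ∑' a, q a * f a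

namespace PMF

theorem expect_pure (a : α) (f : α → ℝ≥0∞) : (PMF.pure a).expect f = f a := by
  classical
  unfold expect
  rw [tsum_eq_single a]
  · simp
  · intro b hb
    simp [PMF.pure_apply, hb]

theorem expect_bind (q : PMF α) (g : α → PMF β) (f : β → ℝ≥0∞) :
    (q.bind g).expect f = q.expect fun a => (g a).expect f := by
  simp only [expect, PMF.bind_apply, ← ENNReal.tsum_mul_right, ← ENNReal.tsum_mul_left]
  rw [ENNReal.tsum_comm]
  simp only [mul_assoc]

theorem expect_map (q : PMF α) (g : α → β) (f : β → ℝ≥0∞) :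
    (q.map g).expect f = q.expect fun a => f (g a) := by
  rw [← PMF.bind_pure_comp, expect_bind]
  simp [expect_pure]

theorem expect_mono (q : PMF α) {f g : α → ℝ≥0∞} (h : ∀ a, q a ≠ 0 → f a ≤ g a) :
    q.expect f ≤ q.expect g := by
  refine ENNReal.tsum_le_tsum fun a => ?_
  by_cases ha : q a = 0
  · simp [ha]
  · gcongr
    exact h a ha

theorem expect_congr (q : PMF α) {f g : α → ℝ≥0∞} (h : ∀ a, q a ≠ 0 → f a = g a) :
    q.expect f = q.expect g :=
  le_antisymm (q.expect_mono fun a ha => (h a ha).le) (q.expect_mono fun a ha => (h a ha).ge)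

theorem expect_add (q : PMF α) (f g : α → ℝ≥0∞) :
    (q.expect fun a => f a + g a) = q.expect f + q.expect g := by
  simp only [expect, mul_add, ENNReal.tsum_add]

theorem mul_le_expect (q : PMF α) (f : α → ℝ≥0∞) (a : α) : q a * f a ≤ q.expect f :=
  ENNReal.le_tsum a

end PMF

namespace RandomLoop

variable {σ β : Type*} (M : RandomLoop σ β)

/-- The set `I` of states contains the initial states and is closed under the steps of `M`. -/
def IsInvariant (I : σ → Prop) : Prop :=
  (∀ s, M.init s ≠ 0 → I s) ∧ ∀ s s', I s → M.step s (Sum.inl s') ≠ 0 → I s'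

variable {M}

theorem IsInvariant.run {I : σ → Prop} (hI : M.IsInvariant I) :
    ∀ t s, M.run t (Sum.inl s) ≠ 0 → I s
  | 0, s, h => by
    rw [RandomLoop.run, ← PMF.mem_support_iff, PMF.mem_support_map_iff] at h
    obtain ⟨s', hs', h⟩ := h
    cases h
    exact hI.1 _ hs'
  | t + 1, s, h => by
    rw [RandomLoop.run, ← PMF.mem_support_iff, PMF.mem_support_bind_iff] at h
    obtain ⟨x, hx, h⟩ := h
    cases x with
    | inl s' => exact hI.2 s' s (hI.run t s' hx) h
    | inr b => simp at h

theorem expect_run_succ (t : ℕ) (f : σ ⊕ β → ℝ≥0∞) :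
    (M.run (t + 1)).expect f =
      (M.run t).expect (Sum.elim (fun s => (M.step s).expect f) fun b => f (Sum.inr b)) := by
  rw [RandomLoop.run, PMF.expect_bind]
  congr 1
  ext x
  cases x <;> simp [PMF.expect_pure]

/-- An observable that is preserved in mean by every step is preserved in mean by the run. -/
theorem expect_run_eq {I : σ → Prop} (hI : M.IsInvariant I) (f : σ ⊕ β → ℝ≥0∞)
    (h : ∀ s, I s → (M.step s).expect f = f (Sum.inl s)) :
    ∀ t, (M.run t).expect f = M.init.expect fun s => f (Sum.inl s)
  | 0 => by rw [RandomLoop.run, PMF.expect_map]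
  | t + 1 => by
    rw [expect_run_succ, ← expect_run_eq hI f h t]
    refine PMF.expect_congr _ fun x hx => ?_
    cases x with
    | inl s => exact h s (hI.run t s hx)
    | inr b => rfl

open Classical in
/-- The value `H s` before halting, and the indicator of the output `b` after it. -/
noncomputable def withOutput (H : σ → ℝ≥0∞) (b : β) : σ ⊕ β → ℝ≥0∞ :=
  Sum.elim H fun b' => if b' = b then 1 else 0

/-- `withOutput H b` is a martingale along the run, so its mean at every time is the initial mean of
`H`, and the outcome `b` contributes one term of that mean. -/
theorem outputLaw_le {I : σ → Prop} (hI : M.IsInvariant I) (H : σ → ℝ≥0∞) (b : β)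
    (h : ∀ s, I s → (M.step s).expect (withOutput H b) = H s) :
    M.outputLaw b ≤ M.init.expect H := by
  refine iSup_le fun t => ?_
  rw [show M.init.expect H = (M.run t).expect (withOutput H b) from
    (expect_run_eq hI (withOutput H b) h t).symm]
  simpa [withOutput] using (M.run t).mul_le_expect (withOutput H b) (Sum.inr b)

/-- What `outputLaw_le` loses is the mean of `H` over the runs still going. As `H ≤ 1`, this is at
most the probability of not having halted, which tends to zero as the term of a convergent series.
-/
theorem outputLaw_eq {I : σ → Prop} (hI : M.IsInvariant I) (H : σ → ℝ≥0∞) (b : β)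
    (h : ∀ s, I s → (M.step s).expect (withOutput H b) = H s)
    (hH : ∀ s, I s → H s ≤ 1) (hM : M.expectedSteps ≠ ∞) :
    M.outputLaw b = M.init.expect H := by
  classical
  refine le_antisymm (outputLaw_le hI H b h) ?_
  have h1 : ∀ t, M.init.expect H ≤ M.outputLaw b + ∑' s, M.run t (Sum.inl s) := by
    intro t
    rw [show M.init.expect H = (M.run t).expect (withOutput H b) from
      (expect_run_eq hI (withOutput H b) h t).symm, PMF.expect,
      Summable.tsum_sum ENNReal.summable ENNReal.summable, add_comm]
    gcongr with s
    · rw [tsum_eq_single b]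
      · have h4 : M.run t (Sum.inr b) ≤ M.outputLaw b := le_iSup (fun t => M.run t (Sum.inr b)) t
        simpa [withOutput] using h4
      · intro b' hb'
        simp [withOutput, hb']
    · by_cases hs : M.run t (Sum.inl s) = 0
      · simp [hs]
      · exact mul_le_of_le_one_right' (hH s (hI.run t s hs))
  have h2 := ENNReal.tendsto_atTop_zero_of_tsum_ne_top hM
  have h3 := Filter.Tendsto.const_add (M.outputLaw b) h2
  rw [add_zero] at h3
  exact ge_of_tendsto' h3 h1

/-- Each step costs one and lowers the mean of `G` by at least one, so the steps so far plus the
current mean of `G` never exceed the initial mean. Almost sure halting is not presupposed. -/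
theorem expectedSteps_le {I : σ → Prop} (hI : M.IsInvariant I) (G : σ → ℝ≥0∞)
    (h : ∀ s, I s → 1 + (M.step s).expect (Sum.elim G fun _ => 0) ≤ G s) :
    M.expectedSteps ≤ M.init.expect G := by
  have key : ∀ n, (∑ t ∈ range n, ∑' s, M.run t (Sum.inl s)) +
      (M.run n).expect (Sum.elim G fun _ => 0) ≤ M.init.expect G := by
    intro n
    induction n with
    | zero => simp [RandomLoop.run, PMF.expect_map]
    | succ n ih =>
      refine le_trans ?_ ih
      rw [Finset.sum_range_succ, add_assoc, expect_run_succ]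
      gcongr
      have : ∑' s, M.run n (Sum.inl s) =
          (M.run n).expect (Sum.elim (fun _ => 1) fun _ => 0) := by
        rw [PMF.expect, Summable.tsum_sum ENNReal.summable ENNReal.summable]
        simp
      rw [this, ← PMF.expect_add]
      refine PMF.expect_mono _ fun x hx => ?_
      cases x with
      | inl s => exact h s (hI.run n s hx)
      | inr b => simp
  refine ENNReal.tsum_le_of_sum_range_le fun n => le_trans le_self_add (key n)

end RandomLoop

end Expectation

/-! ### Calculus of resampling: linearity, composition, commutation. -/

section Resampling

variable {V : Type*} [DecidableEq V] (p : V × V → Set.Ioo (0 : ℝ) 1)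

/-- The expectation of `f` after the arcs in `D` have been resampled, starting from `S`. -/
noncomputable def resampleExp (D : Finset (V × V)) (f : Finset (V × V) → ℝ≥0∞)
    (S : Finset (V × V)) : ℝ≥0∞ :=
  ∑ T ∈ D.powerset, drawArcs p D T * f (S \ D ∪ T)

variable {p}

theorem drawArcs_apply_of_subset {D T : Finset (V × V)} (h : T ⊆ D) :
    drawArcs p D T = (∏ a ∈ T, ENNReal.ofReal (1 - (p a : ℝ))) *
      ∏ a ∈ D \ T, ENNReal.ofReal (p a : ℝ) := by
  simp [drawArcs, h]

theorem drawArcs_eq_zero {D T : Finset (V × V)} (h : ¬ T ⊆ D) : drawArcs p D T = 0 := by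
  simp [drawArcs, h]

theorem drawArcs_ne_zero {D T : Finset (V × V)} (h : T ⊆ D) : drawArcs p D T ≠ 0 := by
  rw [drawArcs_apply_of_subset h]
  refine mul_ne_zero (Finset.prod_ne_zero_iff.2 fun a _ => ?_)
    (Finset.prod_ne_zero_iff.2 fun a _ => ?_)
  · simpa using (p a).2.2
  · simpa using (p a).2.1

theorem sum_drawArcs (D : Finset (V × V)) : ∑ T ∈ D.powerset, drawArcs p D T = 1 := by
  rw [← drawArcs_sum_eq_one p D]
  refine Finset.sum_congr rfl fun T hT => ?_
  rw [if_pos (Finset.mem_powerset.1 hT), drawArcs_apply_of_subset (Finset.mem_powerset.1 hT)]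

theorem expect_drawArcs (D : Finset (V × V)) (f : Finset (V × V) → ℝ≥0∞) :
    (drawArcs p D).expect f = ∑ T ∈ D.powerset, drawArcs p D T * f T := by
  rw [PMF.expect, tsum_eq_sum]
  intro T hT
  rw [drawArcs_eq_zero (fun h => hT (Finset.mem_powerset.2 h)), zero_mul]

theorem expect_resample (D S : Finset (V × V)) (f : Finset (V × V) → ℝ≥0∞) :
    (resample p D S).expect f = resampleExp p D f S := by
  rw [resample, PMF.expect_map, expect_drawArcs, resampleExp]

theorem expect_drawArcs_eq_resampleExp (D : Finset (V × V)) (f : Finset (V × V) → ℝ≥0∞) :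
    (drawArcs p D).expect f = resampleExp p D f ∅ := by
  rw [expect_drawArcs, resampleExp]
  simp

theorem mem_support_resample {D S S' : Finset (V × V)} (h : resample p D S S' ≠ 0) :
    ∃ T ⊆ D, S' = S \ D ∪ T := by
  rw [resample, ← PMF.mem_support_iff, PMF.mem_support_map_iff] at h
  obtain ⟨T, hT, rfl⟩ := h
  refine ⟨T, ?_, rfl⟩
  by_contra h
  exact hT (drawArcs_eq_zero h)

theorem resampleExp_mono {D S : Finset (V × V)} {f g : Finset (V × V) → ℝ≥0∞}
    (h : ∀ T ⊆ D, f (S \ D ∪ T) ≤ g (S \ D ∪ T)) :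
    resampleExp p D f S ≤ resampleExp p D g S := by
  refine Finset.sum_le_sum fun T hT => ?_
  gcongr
  exact h T (Finset.mem_powerset.1 hT)

theorem resampleExp_congr {D S : Finset (V × V)} {f g : Finset (V × V) → ℝ≥0∞}
    (h : ∀ T ⊆ D, f (S \ D ∪ T) = g (S \ D ∪ T)) :
    resampleExp p D f S = resampleExp p D g S :=
  le_antisymm (resampleExp_mono fun T hT => (h T hT).le)
    (resampleExp_mono fun T hT => (h T hT).ge)

theorem resampleExp_const (D S : Finset (V × V)) (x : ℝ≥0∞) :
    resampleExp p D (fun _ => x) S = x := by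
  rw [resampleExp, ← Finset.sum_mul, sum_drawArcs, one_mul]

theorem resampleExp_add (D S : Finset (V × V)) (f g : Finset (V × V) → ℝ≥0∞) :
    resampleExp p D (fun S => f S + g S) S = resampleExp p D f S + resampleExp p D g S := by
  simp only [resampleExp, mul_add, Finset.sum_add_distrib]

theorem resampleExp_sum {ι : Type*} (s : Finset ι) (D S : Finset (V × V))
    (f : ι → Finset (V × V) → ℝ≥0∞) :
    resampleExp p D (fun S => ∑ i ∈ s, f i S) S = ∑ i ∈ s, resampleExp p D (f i) S := by
  simp only [resampleExp, Finset.mul_sum]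
  exact Finset.sum_comm

theorem resampleExp_const_mul (D S : Finset (V × V)) (x : ℝ≥0∞)
    (f : Finset (V × V) → ℝ≥0∞) :
    resampleExp p D (fun S => x * f S) S = x * resampleExp p D f S := by
  simp only [resampleExp, Finset.mul_sum]
  exact Finset.sum_congr rfl fun T _ => by ring

/-- A factor that does not depend on the resampled arcs can be taken out. -/
theorem resampleExp_mul_left {D S : Finset (V × V)} {g : Finset (V × V) → ℝ≥0∞}
    (hg : ∀ T ⊆ D, g (S \ D ∪ T) = g S) (f : Finset (V × V) → ℝ≥0∞) :
    resampleExp p D (fun S => g S * f S) S = g S * resampleExp p D f S := by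
  rw [← resampleExp_const_mul]
  exact resampleExp_congr fun T hT => by rw [hg T hT]

theorem resampleExp_iSup {D S : Finset (V × V)} {f : ℕ → Finset (V × V) → ℝ≥0∞}
    (hf : ∀ S, Monotone fun t => f t S) :
    resampleExp p D (fun S => ⨆ t, f t S) S = ⨆ t, resampleExp p D (f t) S := by
  simp only [resampleExp, ENNReal.mul_iSup]
  refine ENNReal.finsetSum_iSup_of_monotone fun T => ?_
  intro a b hab
  dsimp only
  gcongr
  exact hf _ hab

theorem resampleExp_empty (S : Finset (V × V)) (f : Finset (V × V) → ℝ≥0∞) :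
    resampleExp p ∅ f S = f S := by
  have h : drawArcs p ∅ ∅ = 1 := by simpa using sum_drawArcs (p := p) ∅
  simp [resampleExp, h]

/-- Resampling does not look at the arcs that are resampled. -/
theorem resampleExp_congr_start {D S S' : Finset (V × V)} (h : S \ D = S' \ D)
    (f : Finset (V × V) → ℝ≥0∞) : resampleExp p D f S = resampleExp p D f S' := by
  rw [resampleExp, resampleExp, h]

/-- Conditioning on whether `a` is present. Since `a ∉ D`, its value can be written into the
starting set, where resampling `D` leaves it alone; composition of resamplings follows by induction.
-/
theorem resampleExp_insert {a : V × V} {D : Finset (V × V)} (ha : a ∉ D)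
    (f : Finset (V × V) → ℝ≥0∞) (S : Finset (V × V)) :
    resampleExp p (insert a D) f S =
      ENNReal.ofReal (p a : ℝ) * resampleExp p D f (S.erase a) +
        ENNReal.ofReal (1 - (p a : ℝ)) * resampleExp p D f (insert a S) := by
  rw [resampleExp, Finset.sum_powerset_insert ha, resampleExp, resampleExp, Finset.mul_sum,
    Finset.mul_sum]
  congr 1
  · refine Finset.sum_congr rfl fun T hT => ?_
    rw [Finset.mem_powerset] at hT
    have haT : a ∉ T := fun h => ha (hT h)
    rw [drawArcs_apply_of_subset hT,
      drawArcs_apply_of_subset (hT.trans (Finset.subset_insert a D)),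
      Finset.insert_sdiff_of_notMem _ haT,
      Finset.prod_insert (fun h => ha (Finset.mem_sdiff.1 h).1)]
    have : S \ insert a D = S.erase a \ D := by
      ext x; simp only [mem_sdiff, mem_insert, mem_erase]; tauto
    rw [this]
    ring
  · refine Finset.sum_congr rfl fun T hT => ?_
    rw [Finset.mem_powerset] at hT
    have haT : a ∉ T := fun h => ha (hT h)
    rw [drawArcs_apply_of_subset hT, drawArcs_apply_of_subset (Finset.insert_subset_insert a hT),
      Finset.prod_insert haT]
    have h1 : insert a D \ insert a T = D \ T := by
      ext x; simp only [mem_sdiff, mem_insert]; grind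
    have h2 : S \ insert a D ∪ insert a T = insert a S \ D ∪ T := by
      ext x; simp only [mem_sdiff, mem_insert, mem_union]; grind
    rw [h1, h2]
    ring

/-- Resampling two disjoint sets of arcs in turn is resampling their union. -/
theorem resampleExp_resampleExp {D D' : Finset (V × V)} (h : Disjoint D D')
    (f : Finset (V × V) → ℝ≥0∞) (S : Finset (V × V)) :
    resampleExp p D (resampleExp p D' f) S = resampleExp p (D ∪ D') f S := by
  induction D using Finset.induction_on generalizing S with
  | empty => rw [resampleExp_empty, Finset.empty_union]
  | insert a D ha ih =>
    rw [Finset.disjoint_insert_left] at h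
    rw [resampleExp_insert ha, ih h.2, ih h.2, Finset.insert_union, resampleExp_insert]
    simp [ha, h.1]

theorem resampleExp_comm {D D' : Finset (V × V)} (h : Disjoint D D')
    (f : Finset (V × V) → ℝ≥0∞) (S : Finset (V × V)) :
    resampleExp p D (resampleExp p D' f) S = resampleExp p D' (resampleExp p D f) S := by
  rw [resampleExp_resampleExp h, resampleExp_resampleExp h.symm, Finset.union_comm]

theorem resampleExp_sdiff {D A : Finset (V × V)} (h : D ⊆ A)
    (f : Finset (V × V) → ℝ≥0∞) (S : Finset (V × V)) :
    resampleExp p (A \ D) (resampleExp p D f) S = resampleExp p A f S := by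
  rw [resampleExp_resampleExp Finset.sdiff_disjoint, Finset.sdiff_union_of_subset h]

end Resampling

/-! ### Clusters and root-connectedness. -/

section Clusters

variable {V : Type*} {r : V} {S S' : Finset (V × V)} {C : Finset V}

/-- Being closed concerns only the arcs with tail in `C`. This locality is the source of all
independence between disjoint clusters. -/
theorem isCluster_congr (h : ∀ u ∈ C, ∀ v, (u, v) ∈ S ↔ (u, v) ∈ S') :
    IsCluster r S C ↔ IsCluster r S' C := by
  unfold IsCluster
  refine and_congr_right fun _ => and_congr_right fun _ => forall_congr' fun u =>
    forall_congr' fun v => ?_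
  constructor
  · intro h1 h2 h3
    exact h1 ((h u h3 v).2 h2) h3
  · intro h1 h2 h3
    exact h1 ((h u h3 v).1 h2) h3

theorem isMinimalCluster_congr (h : ∀ u ∈ C, ∀ v, (u, v) ∈ S ↔ (u, v) ∈ S') :
    IsMinimalCluster r S C ↔ IsMinimalCluster r S' C := by
  have key : ∀ {S S' : Finset (V × V)}, (∀ u ∈ C, ∀ v, (u, v) ∈ S ↔ (u, v) ∈ S') →
      IsMinimalCluster r S C → IsMinimalCluster r S' C := by
    intro S S' h hC
    refine ⟨(isCluster_congr h).1 hC.1, fun C' hC' hle => hC.2 ?_ hle⟩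
    exact (isCluster_congr fun u hu => h u (hle hu)).2 hC'
  exact ⟨key h, key fun u hu v => (h u hu v).symm⟩

theorem IsCluster.exists_isMinimalCluster (hC : IsCluster r S C) :
    ∃ C' ⊆ C, IsMinimalCluster r S C' := by
  obtain ⟨C', hle, h⟩ := (Finset.finite_toSet C.powerset).inter_of_right {C' | IsCluster r S C'}
    |>.exists_le_minimal (a := C) ⟨hC, by simp⟩
  refine ⟨C', hle, h.1.1, fun D hD hDC => h.2 ⟨hD, ?_⟩ hDC⟩
  simpa using hDC.trans hle

theorem not_isCluster_of_forall_not_isMinimalCluster (h : ∀ C, ¬ IsMinimalCluster r S C) :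
    ¬ IsCluster r S C := fun hC => by
  obtain ⟨C', -, hC'⟩ := hC.exists_isMinimalCluster
  exact h C' hC'

theorem not_isCluster_of_rootConnected (h : RootConnected r S) : ¬ IsCluster r S C := by
  rintro ⟨⟨v, hv⟩, hr, hC⟩
  refine hr ?_
  have : ∀ w, Relation.ReflTransGen (fun x y => (x, y) ∈ S) v w → w ∈ C := by
    intro w hw
    induction hw with
    | refl => exact hv
    | tail _ h ih => exact hC _ _ h ih
  exact this r (h v)

/-- The vertices that do not reach `r` are closed under arcs, so they form a cluster unless there
are none. -/
theorem rootConnected_of_forall_not_isCluster [Fintype V] (h : ∀ C, ¬ IsCluster r S C) :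
    RootConnected r S := by
  classical
  intro v
  by_contra hv
  refine h (univ.filter fun w => ¬ Relation.ReflTransGen (fun x y => (x, y) ∈ S) w r)
    ⟨⟨v, by simpa using hv⟩, by simpa using Relation.ReflTransGen.refl, ?_⟩
  intro a b hab ha
  simp only [mem_filter, mem_univ, true_and] at ha ⊢
  exact fun hb => ha (Relation.ReflTransGen.head hab hb)

theorem rootConnected_iff [Fintype V] :
    RootConnected r S ↔ ∀ C, ¬ IsMinimalCluster r S C :=
  ⟨fun h _ hC => not_isCluster_of_rootConnected h hC.1,
    fun h => rootConnected_of_forall_not_isCluster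
      fun _ => not_isCluster_of_forall_not_isMinimalCluster h⟩

theorem RootConnected.mono (h : RootConnected r S) (hS : S ⊆ S') : RootConnected r S' :=
  fun v => Relation.ReflTransGen.mono (fun _ _ hab => hS hab) _ _ (h v)

end Clusters

/-! ### Independence of disjoint minimal clusters. -/

section Clusters

variable {V : Type*} [DecidableEq V]

/-- The arcs of `A` with tail in `C`. -/
def outArcs (A : Finset (V × V)) (C : Finset V) : Finset (V × V) := A.filter fun a => a.1 ∈ C

theorem mem_outArcs {A : Finset (V × V)} {C : Finset V} {a : V × V} :
    a ∈ outArcs A C ↔ a ∈ A ∧ a.1 ∈ C := by simp [outArcs]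

theorem outArcs_subset (A : Finset (V × V)) (C : Finset V) : outArcs A C ⊆ A :=
  Finset.filter_subset _ _

theorem disjoint_outArcs (A : Finset (V × V)) {C C' : Finset V} (h : Disjoint C C') :
    Disjoint (outArcs A C) (outArcs A C') := by
  rw [Finset.disjoint_left] at h ⊢
  intro a h1 h2
  exact h (mem_outArcs.1 h1).2 (mem_outArcs.1 h2).2

variable {r : V} {S S' A : Finset (V × V)} {C C' : Finset V} {p : V × V → Set.Ioo (0 : ℝ) 1}

theorem mem_resampled_iff {D T : Finset (V × V)} {a : V × V} (hT : T ⊆ D) (ha : a ∉ D) :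
    a ∈ S \ D ∪ T ↔ a ∈ S := by
  have : a ∉ T := fun h => ha (hT h)
  simp [ha, this]

/-- Resampling the arcs out of `C` does not affect the clusters disjoint from `C`. -/
theorem isMinimalCluster_resampled {T : Finset (V × V)} (hT : T ⊆ outArcs A C)
    (hC : Disjoint C C') :
    IsMinimalCluster r (S \ outArcs A C ∪ T) C' ↔ IsMinimalCluster r S C' := by
  refine isMinimalCluster_congr fun u hu v => mem_resampled_iff hT fun h => ?_
  exact Finset.disjoint_left.1 hC (mem_outArcs.1 h).2 hu

/-- A nonempty intersection of two clusters is again a cluster, and minimality would make both equal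
to it. -/
theorem IsMinimalCluster.disjoint (hC : IsMinimalCluster r S C) (hC' : IsMinimalCluster r S C')
    (hne : C ≠ C') : Disjoint C C' := by
  rw [Finset.disjoint_iff_inter_eq_empty]
  by_contra h
  have hI : IsCluster r S (C ∩ C') := by
    refine ⟨Finset.nonempty_iff_ne_empty.2 h, fun hr => hC.1.2.1 (Finset.mem_inter.1 hr).1, ?_⟩
    intro u v huv hu
    rw [Finset.mem_inter] at hu ⊢
    exact ⟨hC.1.2.2 u v huv hu.1, hC'.1.2.2 u v huv hu.2⟩
  exact hne (le_antisymm
    ((hC.2 hI Finset.inter_subset_left).trans Finset.inter_subset_right)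
    ((hC'.2 hI Finset.inter_subset_right).trans Finset.inter_subset_left))

end Clusters

/-! ### Popping one minimal cluster at a time: order-independence and halting. -/

section SequentialPopping

variable {V : Type*} [DecidableEq V] (A : Finset (V × V)) (r : V)
  (p : V × V → Set.Ioo (0 : ℝ) 1)

open Classical in
/-- The mean of `f` at the output, over the runs that halt after at most `t` pops, when some
minimal cluster is popped at a time. -/
noncomputable def popValue (f : Finset (V × V) → ℝ≥0∞) : ℕ → Finset (V × V) → ℝ≥0∞
  | 0, S => if ∃ C, IsMinimalCluster r S C then 0 else f S
  | t + 1, S => if h : ∃ C, IsMinimalCluster r S C then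
      resampleExp p (outArcs A h.choose) (popValue f t) S else f S

open Classical in
/-- The mean total cost of the pops, over the runs that halt after at most `t` pops. -/
noncomputable def popCost (κ : Finset V → ℝ≥0∞) : ℕ → Finset (V × V) → ℝ≥0∞
  | 0, _ => 0
  | t + 1, S => if h : ∃ C, IsMinimalCluster r S C then
      resampleExp p (outArcs A h.choose) (popCost κ t) S +
        κ h.choose * popValue A r p 1 (t + 1) S else 0

variable {A r p} {S : Finset (V × V)} {C : Finset V} {f : Finset (V × V) → ℝ≥0∞}
  {κ : Finset V → ℝ≥0∞}

theorem popValue_of_forall_not (h : ∀ C, ¬ IsMinimalCluster r S C) (t : ℕ) :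
    popValue A r p f t S = f S := by
  cases t <;> simp [popValue, h]

theorem popCost_of_forall_not (h : ∀ C, ¬ IsMinimalCluster r S C) (t : ℕ) :
    popCost A r p κ t S = 0 := by
  cases t <;> simp [popCost, h]

theorem popValue_zero (hC : IsMinimalCluster r S C) : popValue A r p f 0 S = 0 := by
  have : ∃ C, IsMinimalCluster r S C := ⟨C, hC⟩
  simp [popValue, this]

/-- As long as another minimal cluster is left, popping `C` first cannot yield an output. -/
theorem resampleExp_popValue_zero (hC : IsMinimalCluster r S C) {C' : Finset V}
    (hC' : IsMinimalCluster r S C') (hne : C ≠ C') :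
    resampleExp p (outArcs A C) (popValue A r p f 0) S = 0 := by
  rw [resampleExp_congr (g := fun _ => 0), resampleExp_const]
  intro T hT
  exact popValue_zero ((isMinimalCluster_resampled hT (hC.disjoint hC' hne)).2 hC')

/-- The value does not depend on which minimal cluster is popped first. -/
theorem popValue_succ (hC : IsMinimalCluster r S C) (t : ℕ) :
    popValue A r p f (t + 1) S = resampleExp p (outArcs A C) (popValue A r p f t) S := by
  induction t generalizing S C with
  | zero =>
    have h : ∃ C, IsMinimalCluster r S C := ⟨C, hC⟩
    rw [popValue, dif_pos h]
    by_cases hne : h.choose = C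
    · rw [hne]
    · rw [resampleExp_popValue_zero h.choose_spec hC hne,
        resampleExp_popValue_zero hC h.choose_spec (Ne.symm hne)]
  | succ t ih =>
    have h : ∃ C, IsMinimalCluster r S C := ⟨C, hC⟩
    rw [popValue, dif_pos h]
    by_cases hne : h.choose = C
    · rw [hne]
    -- The diamond: each of the two clusters is still minimal after the other is popped, so by
    -- induction both can be popped next, in either order.
    · have hd := h.choose_spec.disjoint hC hne
      rw [resampleExp_congr (g := resampleExp p (outArcs A C) (popValue A r p f t)),
        resampleExp_comm (disjoint_outArcs A hd)]
      · refine resampleExp_congr fun T hT => (ih ?_).symm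
        exact (isMinimalCluster_resampled hT hd.symm).2 h.choose_spec
      · intro T hT
        exact ih ((isMinimalCluster_resampled hT hd).2 hC)

/-- The same diamond as for `popValue_succ`: the two clusters contribute both their costs in either
order. Exact symmetry at a finite horizon needs the cost to be weighted by the probability of
halting within it; the cost of the first `t` pops of all runs would depend on the order. -/
theorem popCost_succ (hC : IsMinimalCluster r S C) (t : ℕ) :
    popCost A r p κ (t + 1) S = resampleExp p (outArcs A C) (popCost A r p κ t) S +
      κ C * popValue A r p 1 (t + 1) S := by
  induction t generalizing S C with
  | zero =>
    have h : ∃ C, IsMinimalCluster r S C := ⟨C, hC⟩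
    rw [popCost, dif_pos h]
    by_cases hne : h.choose = C
    · rw [hne]
    · have h0 : popValue A r p 1 1 S = 0 := by
        rw [popValue_succ hC, resampleExp_popValue_zero hC h.choose_spec (Ne.symm hne)]
      have h1 : popCost A r p κ 0 = fun _ => 0 := rfl
      rw [h0, h1, resampleExp_const, resampleExp_const, mul_zero, mul_zero]
  | succ t ih =>
    have h : ∃ C, IsMinimalCluster r S C := ⟨C, hC⟩
    rw [popCost, dif_pos h]
    by_cases hne : h.choose = C
    · rw [hne]
    · have hd := h.choose_spec.disjoint hC hne
      have key : ∀ {C C' : Finset V}, IsMinimalCluster r S C → IsMinimalCluster r S C' →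
          Disjoint C C' → resampleExp p (outArcs A C) (popCost A r p κ (t + 1)) S =
            resampleExp p (outArcs A C) (resampleExp p (outArcs A C') (popCost A r p κ t)) S +
              κ C' * popValue A r p 1 (t + 2) S := by
        intro C C' hC hC' hd
        rw [popValue_succ hC, ← resampleExp_const_mul, ← resampleExp_add]
        exact resampleExp_congr fun T hT => ih ((isMinimalCluster_resampled hT hd).2 hC')
      rw [key h.choose_spec hC hd, key hC h.choose_spec hd.symm,
        resampleExp_comm (disjoint_outArcs A hd)]
      ring

theorem popValue_mono_nat (S : Finset (V × V)) : Monotone fun t => popValue A r p f t S := by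
  refine monotone_nat_of_le_succ fun t => ?_
  induction t generalizing S with
  | zero =>
    by_cases h : ∃ C, IsMinimalCluster r S C
    · rw [popValue_zero h.choose_spec]
      exact zero_le
    · push Not at h
      rw [popValue_of_forall_not h, popValue_of_forall_not h]
  | succ t ih =>
    by_cases h : ∃ C, IsMinimalCluster r S C
    · rw [popValue_succ h.choose_spec, popValue_succ h.choose_spec]
      exact resampleExp_mono fun T _ => ih _
    · push Not at h
      rw [popValue_of_forall_not h, popValue_of_forall_not h]

theorem popCost_mono_nat (S : Finset (V × V)) : Monotone fun t => popCost A r p κ t S := by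
  refine monotone_nat_of_le_succ fun t => ?_
  induction t generalizing S with
  | zero => exact zero_le
  | succ t ih =>
    by_cases h : ∃ C, IsMinimalCluster r S C
    · rw [popCost_succ h.choose_spec, popCost_succ h.choose_spec]
      gcongr
      · exact resampleExp_mono fun T _ => ih _
      · exact popValue_mono_nat S (Nat.le_succ _)
    · push Not at h
      rw [popCost_of_forall_not h, popCost_of_forall_not h]

theorem popValue_mono {g : Finset (V × V) → ℝ≥0∞} (hfg : f ≤ g) (t : ℕ) (S : Finset (V × V)) :
    popValue A r p f t S ≤ popValue A r p g t S := by
  induction t generalizing S with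
  | zero =>
    rw [popValue, popValue]
    split_ifs
    · exact le_rfl
    · exact hfg S
  | succ t ih =>
    rw [popValue, popValue]
    split_ifs
    · exact resampleExp_mono fun T _ => ih _
    · exact hfg S

theorem popValue_one_le_one (t : ℕ) (S : Finset (V × V)) : popValue A r p 1 t S ≤ 1 := by
  induction t generalizing S with
  | zero =>
    rw [popValue]
    split_ifs <;> simp
  | succ t ih =>
    rw [popValue]
    split_ifs
    · exact (resampleExp_mono (g := fun _ => 1) fun T _ => ih _).trans_eq (resampleExp_const _ _ _)
    · simp

theorem popValue_sum {ι : Type*} (s : Finset ι) (g : ι → Finset (V × V) → ℝ≥0∞) (t : ℕ)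
    (S : Finset (V × V)) :
    popValue A r p (fun S => ∑ i ∈ s, g i S) t S = ∑ i ∈ s, popValue A r p (g i) t S := by
  induction t generalizing S with
  | zero =>
    simp only [popValue]
    split_ifs <;> simp
  | succ t ih =>
    simp only [popValue]
    split_ifs
    · rw [← resampleExp_sum]
      exact resampleExp_congr fun T _ => ih _
    · rfl

theorem popCost_sum {ι : Type*} (s : Finset ι) (x : ι → ℝ≥0∞) (κ : ι → Finset V → ℝ≥0∞) (t : ℕ)
    (S : Finset (V × V)) :
    popCost A r p (fun C => ∑ i ∈ s, x i * κ i C) t S =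
      ∑ i ∈ s, x i * popCost A r p (κ i) t S := by
  induction t generalizing S with
  | zero => simp [popCost]
  | succ t ih =>
    by_cases h : ∃ C, IsMinimalCluster r S C
    · simp only [popCost_succ h.choose_spec]
      rw [resampleExp_congr (g := fun S => ∑ i ∈ s, x i * popCost A r p (κ i) t S) fun T _ => ih _,
        resampleExp_sum, Finset.sum_mul,
        ← Finset.sum_add_distrib]
      refine Finset.sum_congr rfl fun i _ => ?_
      rw [resampleExp_const_mul]
      ring
    · push Not at h
      simp [popCost_of_forall_not h]

variable (A r p) in
/-- The mean of `f` at the output of cluster-popping started from `S`. -/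
noncomputable def popLimit (f : Finset (V × V) → ℝ≥0∞) (S : Finset (V × V)) : ℝ≥0∞ :=
  ⨆ t, popValue A r p f t S

variable (A r p) in
/-- The mean total cost of the pops of cluster-popping started from `S`. -/
noncomputable def popLimitCost (κ : Finset V → ℝ≥0∞) (S : Finset (V × V)) : ℝ≥0∞ :=
  ⨆ t, popCost A r p κ t S

theorem popLimit_of_forall_not (h : ∀ C, ¬ IsMinimalCluster r S C) :
    popLimit A r p f S = f S := by
  simp [popLimit, popValue_of_forall_not h]

/-- The limit of `popValue_succ`; the shift of the horizon by one is harmless because the values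
increase with it. -/
theorem popLimit_eq_resampleExp (hC : IsMinimalCluster r S C) :
    popLimit A r p f S = resampleExp p (outArcs A C) (popLimit A r p f) S := by
  rw [show popLimit A r p f = fun S => ⨆ t, popValue A r p f t S from rfl,
    resampleExp_iSup popValue_mono_nat]
  dsimp only
  rw [← (popValue_mono_nat S).iSup_nat_add 1]
  exact iSup_congr fun t => popValue_succ hC t

theorem popLimitCost_eq_resampleExp (hC : IsMinimalCluster r S C) :
    popLimitCost A r p κ S = resampleExp p (outArcs A C) (popLimitCost A r p κ) S +
      κ C * popLimit A r p 1 S := by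
  rw [show popLimitCost A r p κ = fun S => ⨆ t, popCost A r p κ t S from rfl,
    resampleExp_iSup popCost_mono_nat, popLimit]
  dsimp only
  rw [← (popCost_mono_nat S).iSup_nat_add 1, ← (popValue_mono_nat S).iSup_nat_add 1,
    ENNReal.mul_iSup, ENNReal.iSup_add_iSup_of_monotone]
  · exact iSup_congr fun t => popCost_succ hC t
  · intro a b hab
    exact resampleExp_mono fun T _ => popCost_mono_nat _ hab
  · intro a b hab
    dsimp only
    gcongr
    exact popValue_mono_nat _ (by simpa using hab)

theorem popLimit_one_le_one (S : Finset (V × V)) : popLimit A r p 1 S ≤ 1 :=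
  iSup_le fun t => popValue_one_le_one t S

theorem popLimit_mono {g : Finset (V × V) → ℝ≥0∞} (hfg : f ≤ g) (S : Finset (V × V)) :
    popLimit A r p f S ≤ popLimit A r p g S :=
  iSup_mono fun t => popValue_mono hfg t S

theorem popLimit_sum {ι : Type*} (s : Finset ι) (g : ι → Finset (V × V) → ℝ≥0∞)
    (S : Finset (V × V)) :
    popLimit A r p (fun S => ∑ i ∈ s, g i S) S = ∑ i ∈ s, popLimit A r p (g i) S := by
  simp only [popLimit, popValue_sum]
  rw [ENNReal.finsetSum_iSup_of_monotone]
  exact fun i => popValue_mono_nat S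

theorem subset_of_resampled {A D T S : Finset (V × V)} (hS : S ⊆ A) (hD : D ⊆ A) (hT : T ⊆ D) :
    S \ D ∪ T ⊆ A :=
  Finset.union_subset (Finset.sdiff_subset.trans hS) (hT.trans hD)

/-- Nothing is output if the input graph is not root-connected. -/
theorem popLimit_eq_zero [Fintype V] (hA : ¬ RootConnected r A) (hS : S ⊆ A) :
    popLimit A r p f S = 0 := by
  have h : ∀ S ⊆ A, ∃ C, IsMinimalCluster r S C := by
    intro S hS
    by_contra h
    push Not at h
    exact hA ((rootConnected_iff.2 h).mono hS)
  have key : ∀ t, ∀ S ⊆ A, popValue A r p f t S = 0 := by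
    intro t
    induction t with
    | zero => exact fun S hS => popValue_zero (h S hS).choose_spec
    | succ t ih =>
      intro S hS
      rw [popValue_succ (h S hS).choose_spec, resampleExp_congr (g := fun _ => 0),
        resampleExp_const]
      exact fun T hT => ih _ (subset_of_resampled hS (outArcs_subset _ _) hT)
  simp [popLimit, key _ S hS]

/-- Cluster-popping halts almost surely if the input graph is root-connected. -/
theorem popLimit_one_eq_one [Fintype V] (hA : RootConnected r A) (hS : S ⊆ A) :
    popLimit A r p 1 S = 1 := by
  classical
  -- Start from a set with the least halting probability `m`, and move among sets with this same
  -- value until one without minimal clusters is reached; there the value is `1`.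
  obtain ⟨S₀, hS₀, hmin⟩ := Finset.exists_min_image A.powerset (popLimit A r p 1) ⟨A, by simp⟩
  set m := popLimit A r p 1 S₀ with hm
  have hm1 : m ≤ 1 := popLimit_one_le_one S₀
  -- the vertices all of whose arcs are present
  let full : Finset (V × V) → Finset V := fun S => univ.filter fun v => outArcs A {v} ⊆ S
  have key : ∀ n, ∀ S ⊆ A, Fintype.card V - (full S).card = n → popLimit A r p 1 S = m →
      m = 1 := by
    intro n
    induction n using Nat.strong_induction_on with
    | _ n ih =>
      intro S hSA hn hSm
      by_cases h : ∃ C, IsMinimalCluster r S C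
      · obtain ⟨C, hC⟩ := h
        set D := outArcs A C with hD
        have hDA : D ⊆ A := outArcs_subset A C
        have hS'A : S \ D ∪ D ⊆ A := subset_of_resampled hSA hDA Subset.rfl
        have hfull : full S ⊂ full (S \ D ∪ D) := by
          rw [Finset.ssubset_iff_of_subset]
          -- Were no vertex newly full, all vertices of `C` would already have been full, and `C`
          -- would be closed in the whole input graph, which is root-connected.
          · by_contra! hcon
            refine not_isCluster_of_rootConnected hA
              ⟨hC.1.1, hC.1.2.1, fun u v huv hu => hC.1.2.2 u v ?_ hu⟩
            have : u ∈ full S := by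
              refine hcon u ?_
              simp only [full, mem_filter, mem_univ, true_and]
              intro a ha
              rw [mem_outArcs, Finset.mem_singleton] at ha
              exact Finset.mem_union_right _ (mem_outArcs.2 ⟨ha.1, ha.2 ▸ hu⟩)
            simp only [full, mem_filter, mem_univ, true_and] at this
            exact this (mem_outArcs.2 ⟨huv, by simp⟩)
          · intro v hv
            simp only [full, mem_filter, mem_univ, true_and] at hv ⊢
            refine hv.trans ?_
            rw [Finset.sdiff_union_self_eq_union]
            exact Finset.subset_union_left
        have hlt := Finset.card_lt_card hfull
        have hle := Finset.card_le_univ (full (S \ D ∪ D))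
        refine ih _ ?_ (S \ D ∪ D) hS'A rfl ?_
        · omega
        · refine le_antisymm ?_ (hmin _ (Finset.mem_powerset.2 hS'A))
          -- The average of values that are all at least `m` is `m`, and the outcome with all arcs
          -- of `D` present has positive weight, so its value is `m` as well.
          have h1 : resampleExp p D (popLimit A r p 1) S = resampleExp p D (fun _ => m) S := by
            rw [resampleExp_const, ← popLimit_eq_resampleExp hC, hSm]
          rw [resampleExp, resampleExp, ← Finset.add_sum_erase _ _ (Finset.mem_powerset_self D),
            ← Finset.add_sum_erase _ (fun T => drawArcs p D T * m) (Finset.mem_powerset_self D)]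
            at h1
          have h2 : ∑ T ∈ D.powerset.erase D, drawArcs p D T * m ≤
              ∑ T ∈ D.powerset.erase D, drawArcs p D T * popLimit A r p 1 (S \ D ∪ T) := by
            refine Finset.sum_le_sum fun T hT => ?_
            gcongr
            refine hmin _ (Finset.mem_powerset.2 (subset_of_resampled hSA hDA ?_))
            exact Finset.mem_powerset.1 (Finset.mem_of_mem_erase hT)
          have hfin : ∑ T ∈ D.powerset.erase D, drawArcs p D T * m ≠ ∞ :=
            ENNReal.sum_ne_top.2 fun T _ => ENNReal.mul_ne_top (PMF.apply_ne_top _ _)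
              (ne_top_of_le_ne_top ENNReal.one_ne_top hm1)
          have h3 := (add_le_add_right h2 _).trans h1.le
          rw [ENNReal.add_le_add_iff_right hfin] at h3
          exact (ENNReal.mul_le_mul_iff_right (drawArcs_ne_zero Subset.rfl)
            (PMF.apply_ne_top _ _)).1 h3
      · push Not at h
        rw [← hSm, popLimit_of_forall_not h]
        rfl
  have := key _ S₀ (Finset.mem_powerset.1 hS₀) rfl rfl
  refine le_antisymm (popLimit_one_le_one S) ?_
  rw [← this]
  exact hmin S (Finset.mem_powerset.2 hS)

end SequentialPopping

/-! ### The mean number of pops of a given cluster. -/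

section Occupancy

variable {V : Type*}

/-- No set of the family `F` is a minimal cluster. -/
def AvoidsFamily (r : V) (F : Set (Finset V)) (S : Finset (V × V)) : Prop :=
  ∀ C ∈ F, ¬ IsMinimalCluster r S C

/-- `C` is the minimal cluster of the highest priority. -/
def IsTopCluster (r : V) (rk : Finset V → ℕ) (S : Finset (V × V)) (C : Finset V) : Prop :=
  IsMinimalCluster r S C ∧ ∀ C', IsMinimalCluster r S C' → rk C' ≤ rk C

/-- `C` is the only minimal cluster. -/
def IsUniqueCluster (r : V) (S : Finset (V × V)) (C : Finset V) : Prop :=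
  IsMinimalCluster r S C ∧ ∀ C', IsMinimalCluster r S C' → C' = C

/-- The sets that cannot be minimal clusters if `C` is the one of the highest priority and `F` is
avoided; of the sets disjoint from `C` only. -/
def excludedFamily (rk : Finset V → ℕ) (F : Set (Finset V)) (C : Finset V) : Set (Finset V) :=
  {C' | Disjoint C C' ∧ (rk C < rk C' ∨ C' ∈ F)}

open Classical in
/-- The indicator of `P`, in the extended nonnegative reals. -/
noncomputable def indic (P : Prop) : ℝ≥0∞ := if P then 1 else 0

theorem indic_of_true {P : Prop} (h : P) : indic P = 1 := if_pos h

theorem indic_of_false {P : Prop} (h : ¬ P) : indic P = 0 := if_neg h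

theorem indic_le_one (P : Prop) : indic P ≤ 1 := by
  by_cases h : P <;> simp [indic, h]

theorem indic_and (P Q : Prop) : indic (P ∧ Q) = indic P * indic Q := by
  by_cases h : P <;> by_cases h' : Q <;> simp [indic, h, h']

theorem indic_mono {P Q : Prop} (h : P → Q) : indic P ≤ indic Q := by
  by_cases hP : P
  · rw [indic_of_true hP, indic_of_true (h hP)]
  · rw [indic_of_false hP]
    exact zero_le

theorem indic_congr {P Q : Prop} (h : P ↔ Q) : indic P = indic Q := by rw [propext h]

variable {S : Finset (V × V)} {r : V} {rk : Finset V → ℕ}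

theorem exists_isTopCluster [Fintype V] (h : ∃ C, IsMinimalCluster r S C) :
    ∃ C, IsTopCluster r rk S C := by
  classical
  obtain ⟨C, hC, hmax⟩ := Finset.exists_max_image (univ.filter (IsMinimalCluster r S)) rk
    ⟨h.choose, by simpa using h.choose_spec⟩
  refine ⟨C, by simpa using hC, fun C' hC' => hmax C' (by simpa using hC')⟩

theorem IsTopCluster.unique (hrk : Function.Injective rk) {C C' : Finset V}
    (h : IsTopCluster r rk S C) (h' : IsTopCluster r rk S C') : C = C' :=
  hrk (le_antisymm (h'.2 C h.1) (h.2 C' h'.1))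

/-- With injective priorities the top cluster is unique, so exactly one term survives when there is
any minimal cluster. This splits a quantity by the first pop. -/
theorem sum_indic_isTopCluster [Fintype V] (hrk : Function.Injective rk) {x : ℝ≥0∞}
    {y : Finset V → ℝ≥0∞} (h : ∀ C, IsTopCluster r rk S C → x = y C)
    (h0 : (∀ C, ¬ IsMinimalCluster r S C) → x = 0) :
    x = ∑ C, indic (IsTopCluster r rk S C) * y C := by
  by_cases hS : ∃ C, IsMinimalCluster r S C
  · obtain ⟨C, hC⟩ := exists_isTopCluster (rk := rk) hS
    rw [Finset.sum_eq_single C, indic_of_true hC, one_mul, h C hC]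
    · intro C' _ hne
      rw [indic_of_false fun hC' => hne (hC'.unique hrk hC), zero_mul]
    · simp
  · push Not at hS
    rw [h0 hS, Finset.sum_eq_zero]
    intro C _
    rw [indic_of_false fun hC => hS C hC.1, zero_mul]

variable [DecidableEq V] {A : Finset (V × V)} {p : V × V → Set.Ioo (0 : ℝ) 1} {C : Finset V}
  {F : Set (Finset V)}

/-- Minimal clusters are disjoint, so once `C` is one, only sets disjoint from it still have to be
excluded. The right side separates an event about the arcs out of `C` from one that ignores these
arcs. -/
theorem isTopCluster_and_avoidsFamily_iff (hC : C ∉ F) :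
    IsTopCluster r rk S C ∧ AvoidsFamily r F S ↔
      IsMinimalCluster r S C ∧ AvoidsFamily r (excludedFamily rk F C) S := by
  constructor
  · rintro ⟨⟨h1, h2⟩, h3⟩
    refine ⟨h1, fun C' hC' h => ?_⟩
    obtain ⟨-, h4 | h4⟩ := hC'
    · exact absurd (h2 C' h) (by omega)
    · exact h3 C' h4 h
  · rintro ⟨h1, h2⟩
    refine ⟨⟨h1, fun C' h => ?_⟩, fun C' hC' h => ?_⟩
    · by_contra! hlt
      have hne : C ≠ C' := fun h => by simp [h] at hlt
      exact h2 C' ⟨h1.disjoint h hne, Or.inl hlt⟩ h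
    · have hne : C ≠ C' := fun h => hC (h ▸ hC')
      exact h2 C' ⟨h1.disjoint h hne, Or.inr hC'⟩ h

/-- Given which set is popped first, the law after the pop is the initial law conditioned on
avoiding the excluded sets. -/
theorem resampleExp_isTopCluster (hC : C ∉ F)
    (X : Finset (V × V) → ℝ≥0∞) :
    resampleExp p A (fun S => indic (IsTopCluster r rk S C) *
        (indic (AvoidsFamily r F S) * resampleExp p (outArcs A C) X S)) ∅ =
      resampleExp p (outArcs A C) (fun S => indic (IsMinimalCluster r S C)) ∅ *
        resampleExp p A (fun S => indic (AvoidsFamily r (excludedFamily rk F C) S) * X S) ∅ := by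
  set D := outArcs A C with hD
  have hDA : D ⊆ A := outArcs_subset A C
  -- Draw the arcs outside `D` first. Given them, minimality of `C` depends on `D` only, avoidance
  -- of the excluded family not at all, and the pop redraws `D` afresh; so the expectation over `D`
  -- factors.
  rw [← resampleExp_sdiff hDA, ← resampleExp_sdiff hDA (fun S => indic _ * X S),
    ← resampleExp_const_mul]
  refine resampleExp_congr fun T hT => ?_
  have hS : ∅ \ (A \ D) ∪ T = T := by simp
  rw [hS]
  have hav : ∀ T' ⊆ D, indic (AvoidsFamily r (excludedFamily rk F C) (T \ D ∪ T')) =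
      indic (AvoidsFamily r (excludedFamily rk F C) T) := by
    intro T' hT'
    refine indic_congr (forall_congr' fun C' => forall_congr' fun hC' => not_congr ?_)
    exact isMinimalCluster_resampled hT' hC'.1
  have hmin : resampleExp p D (fun S => indic (IsMinimalCluster r S C)) T =
      resampleExp p D (fun S => indic (IsMinimalCluster r S C)) ∅ := by
    refine Finset.sum_congr rfl fun T' hT' => ?_
    congr 1
    refine indic_congr (isMinimalCluster_congr fun u hu v => ?_)
    simp only [mem_union, mem_sdiff, Finset.notMem_empty, false_and, false_or,
      or_iff_right_iff_imp, and_imp]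
    intro h1 h2
    exact absurd (mem_outArcs.2 ⟨(Finset.mem_sdiff.1 (hT h1)).1, hu⟩) h2
  rw [resampleExp_mul_left (g := fun S => indic (AvoidsFamily r (excludedFamily rk F C) S)) hav,
    ← hmin, mul_comm (resampleExp p D _ T), mul_assoc,
    mul_comm (resampleExp p D X T), mul_comm (resampleExp p D _ T) (resampleExp p D X T),
    ← mul_assoc]
  have hconst : ∀ T' ⊆ D, (indic (AvoidsFamily r (excludedFamily rk F C) (T \ D ∪ T')) *
      resampleExp p D X (T \ D ∪ T')) =
      (indic (AvoidsFamily r (excludedFamily rk F C) T) * resampleExp p D X T) := by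
    intro T' hT'
    rw [hav T' hT']
    congr 1
    refine resampleExp_congr_start ?_ X
    ext a
    simp only [mem_sdiff, mem_union]
    have := @hT' a
    tauto
  rw [← resampleExp_mul_left (g := fun S => indic (AvoidsFamily r (excludedFamily rk F C) S) *
      resampleExp p D X S) hconst]
  refine resampleExp_congr fun T' _ => ?_
  rw [← mul_assoc, ← indic_and, indic_congr (isTopCluster_and_avoidsFamily_iff hC), indic_and]
  ring

variable [Fintype V]

/-- The pops at `C₀`, the set of the lowest priority, and the halts happen at the same rate. -/
theorem resampleExp_popCost_le_aux {C₀ : Finset V} (hrk : Function.Injective rk)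
    (h₀ : ∀ C, rk C₀ ≤ rk C) (t : ℕ) (F : Set (Finset V)) (hF : C₀ ∉ F) :
    resampleExp p A (fun S => indic (RootConnected r S)) ∅ *
        resampleExp p A (fun S => indic (AvoidsFamily r F S) *
          popCost A r p (fun C => indic (C = C₀)) t S) ∅ ≤
      resampleExp p A (fun S => indic (IsUniqueCluster r S C₀)) ∅ *
        resampleExp p A (fun S => indic (AvoidsFamily r F S) * popValue A r p 1 t S) ∅ := by
  classical
  induction t generalizing F with
  | zero =>
    have : (fun S => indic (AvoidsFamily r F S) * popCost A r p (fun C => indic (C = C₀)) 0 S) =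
        fun _ => 0 := by
      ext S
      simp [popCost]
    rw [this, resampleExp_const, mul_zero]
    exact zero_le
  | succ t ih =>
    set c : Finset V → ℝ≥0∞ := fun C =>
      resampleExp p (outArcs A C) (fun S => indic (IsMinimalCluster r S C)) ∅ with hc
    -- the decomposition according to the first pop
    have hdec : ∀ X : Finset (V × V) → ℝ≥0∞,
        resampleExp p A (fun S => ∑ C, indic (IsTopCluster r rk S C) *
          (indic (AvoidsFamily r F S) * resampleExp p (outArcs A C) X S)) ∅ =
        ∑ C ∈ univ.filter (· ∉ F), c C *
          resampleExp p A (fun S => indic (AvoidsFamily r (excludedFamily rk F C) S) * X S) ∅ := by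
      intro X
      rw [resampleExp_sum, Finset.sum_filter]
      refine Finset.sum_congr rfl fun C _ => ?_
      split_ifs with hCF
      · rw [resampleExp_congr (g := fun _ => 0), resampleExp_const]
        intro T _
        rw [← mul_assoc, ← indic_and, indic_of_false, zero_mul]
        exact fun h => h.2 C hCF h.1.1
      · exact resampleExp_isTopCluster hCF X
    have hcost : resampleExp p A (fun S => indic (AvoidsFamily r F S) *
          popCost A r p (fun C => indic (C = C₀)) (t + 1) S) ∅ ≤
        resampleExp p A (fun S => ∑ C, indic (IsTopCluster r rk S C) *
          (indic (AvoidsFamily r F S) *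
            resampleExp p (outArcs A C) (popCost A r p (fun C => indic (C = C₀)) t) S)) ∅ +
        resampleExp p A (fun S => indic (IsUniqueCluster r S C₀)) ∅ := by
      rw [← resampleExp_add]
      refine resampleExp_mono fun T _ => ?_
      generalize ∅ \ A ∪ T = S
      by_cases hS : ∃ C, IsMinimalCluster r S C
      · rw [← sum_indic_isTopCluster hrk (x := indic (AvoidsFamily r F S) *
          resampleExp p (outArcs A (exists_isTopCluster (rk := rk) hS).choose)
            (popCost A r p (fun C => indic (C = C₀)) t) S)]
        · set C := (exists_isTopCluster (rk := rk) hS).choose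
          have hC : IsTopCluster r rk S C := (exists_isTopCluster (rk := rk) hS).choose_spec
          rw [popCost_succ hC.1, mul_add]
          gcongr
          refine (mul_le_of_le_one_left' (indic_le_one _)).trans ?_
          refine (mul_le_of_le_one_right' (popValue_one_le_one _ _)).trans (indic_mono ?_)
          -- Having the lowest priority, `C₀` is on top only when it is alone.
          intro hCC
          rw [hCC] at hC
          exact ⟨hC.1, fun C' hC' => hrk (le_antisymm (hC.2 C' hC') (h₀ C'))⟩
        · intro C hC
          rw [((exists_isTopCluster (rk := rk) hS).choose_spec).unique hrk hC]
        · intro h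
          exact absurd hS.choose_spec (h _)
      · push Not at hS
        rw [popCost_of_forall_not hS, mul_zero]
        exact zero_le
    have hvalue : resampleExp p A (fun S => indic (AvoidsFamily r F S) *
          popValue A r p 1 (t + 1) S) ∅ =
        resampleExp p A (fun S => ∑ C, indic (IsTopCluster r rk S C) *
          (indic (AvoidsFamily r F S) *
            resampleExp p (outArcs A C) (popValue A r p 1 t) S)) ∅ +
        resampleExp p A (fun S => indic (RootConnected r S)) ∅ := by
      rw [← resampleExp_add]
      refine resampleExp_congr fun T _ => ?_
      generalize ∅ \ A ∪ T = S
      by_cases hS : ∃ C, IsMinimalCluster r S C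
      · rw [← sum_indic_isTopCluster hrk (x := indic (AvoidsFamily r F S) *
          popValue A r p 1 (t + 1) S), indic_of_false (P := RootConnected r S), add_zero]
        · rw [rootConnected_iff]
          push Not
          exact hS
        · intro C hC
          rw [popValue_succ hC.1]
        · intro h
          exact absurd hS.choose_spec (h _)
      -- A set without minimal clusters avoids every family, so the halting term is the same for all
      -- `F`.
      · push Not at hS
        rw [popValue_of_forall_not hS, indic_of_true (rootConnected_iff.2 hS),
          indic_of_true (P := AvoidsFamily r F S) (fun C _ => hS C), Finset.sum_eq_zero]
        · simp
        · intro C _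
          rw [indic_of_false fun hC => hS C hC.1, zero_mul]
    rw [hvalue, mul_add]
    refine (mul_le_mul_right hcost _).trans ?_
    rw [mul_add]
    refine add_le_add ?_ (mul_comm _ _).le
    rw [hdec, hdec, Finset.mul_sum, Finset.mul_sum]
    refine Finset.sum_le_sum fun C hC => ?_
    rw [mul_left_comm, mul_left_comm _ (c C)]
    refine mul_le_mul_right (ih _ ?_) _
    -- `C₀` is never excluded, as it outranks nothing; so the induction hypothesis applies to the
    -- new family.
    rintro ⟨hd, h | h⟩
    · exact absurd (h₀ C) (by omega)
    · exact hF h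

/-- The priorities may depend on the cluster whose pops are counted, since the cost does not depend
on the order of the pops. -/
theorem exists_injective_minimal (C₀ : Finset V) :
    ∃ rk : Finset V → ℕ, Function.Injective rk ∧ ∀ C, rk C₀ ≤ rk C := by
  classical
  let e := Fintype.equivFin (Finset V)
  refine ⟨fun C => if C = C₀ then 0 else e C + 1, fun C C' h => ?_, fun C => by simp⟩
  dsimp only at h
  split_ifs at h with h1 h2 h2
  · rw [h1, h2]
  · exact e.injective (Fin.ext (by omega))

/-- The mean cost of the pops of cluster-popping, in terms of the probabilities of having a unique
minimal cluster and of having none. -/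
theorem resampleExp_popLimitCost_le (κ : Finset V → ℝ≥0∞) :
    resampleExp p A (fun S => indic (RootConnected r S)) ∅ *
        resampleExp p A (popLimitCost A r p κ) ∅ ≤
      ∑ C, κ C * resampleExp p A (fun S => indic (IsUniqueCluster r S C)) ∅ := by
  classical
  rw [show popLimitCost A r p κ = fun S => ⨆ t, popCost A r p κ t S from rfl,
    resampleExp_iSup popCost_mono_nat, ENNReal.mul_iSup]
  refine iSup_le fun t => ?_
  have hκ : κ = fun C => ∑ C₀, κ C₀ * indic (C = C₀) := by
    ext C
    rw [Finset.sum_eq_single C]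
    · simp [indic]
    · intro C' _ h
      simp [indic, h.symm]
    · simp
  have h1 : popCost A r p κ t = fun S =>
      ∑ C₀, κ C₀ * popCost A r p (fun C => indic (C = C₀)) t S := by
    ext S
    conv_lhs => rw [hκ]
    exact popCost_sum univ κ (fun C₀ C => indic (C = C₀)) t S
  rw [h1, resampleExp_sum, Finset.mul_sum]
  refine Finset.sum_le_sum fun C₀ _ => ?_
  rw [resampleExp_const_mul, mul_left_comm]
  refine mul_le_mul_right ?_ _
  obtain ⟨rk, hrk, h₀⟩ := exists_injective_minimal C₀
  have h2 := resampleExp_popCost_le_aux (A := A) (r := r) (p := p) hrk h₀ t ∅ (by simp)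
  have h3 : ∀ S : Finset (V × V), indic (AvoidsFamily r ∅ S) = 1 := fun S =>
    indic_of_true fun C hC => absurd hC (by simp)
  simp only [h3, one_mul] at h2
  refine h2.trans (mul_le_of_le_one_right' ?_)
  exact (resampleExp_mono (g := fun _ => 1) fun T _ => popValue_one_le_one _ _).trans_eq
    (resampleExp_const _ _ _)

end Occupancy

/-! ### Turning a graph with a unique minimal cluster into a root-connected one. -/

section Repair

variable {V : Type*} {S A : Finset (V × V)} {r u u' x v w : V} {C W : Finset V}

/-- `w` can be reached from `v` along the arcs of `S`. -/
def Reaches (S : Finset (V × V)) (v w : V) : Prop :=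
  Relation.ReflTransGen (fun x y => (x, y) ∈ S) v w

theorem Reaches.refl (S : Finset (V × V)) (v : V) : Reaches S v v := Relation.ReflTransGen.refl

/-- What `v` reaches is closed and misses `r`, hence is a cluster; it contains a minimal one, which
can only be `C`. -/
theorem IsUniqueCluster.reaches [Fintype V] (hC : IsUniqueCluster r S C) (hx : x ∈ C)
    (hv : ¬ Reaches S v r) : Reaches S v x := by
  classical
  have h : IsCluster r S (univ.filter (Reaches S v)) := by
    refine ⟨⟨v, by simpa using Reaches.refl S v⟩, by simpa using hv, ?_⟩
    intro a b hab ha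
    simp only [mem_filter, mem_univ, true_and] at ha ⊢
    exact ha.tail hab
  obtain ⟨C', hle, hC'⟩ := h.exists_isMinimalCluster
  have := hle ((hC.2 C' hC') ▸ hx)
  simpa using this

/-- `u` does not reach the root, `W` is what it reaches, and the arc `u → u'` leads to a vertex
that reaches the root. -/
structure IsRepair (r : V) (S : Finset (V × V)) (W : Finset V) (u u' : V) : Prop where
  not_reaches : ¬ Reaches S u r
  reaches : Reaches S u' r
  mem_iff : ∀ w, w ∈ W ↔ Reaches S u w

namespace IsRepair

theorem not_reaches_of_mem (h : IsRepair r S W u u') (hw : w ∈ W) : ¬ Reaches S w r :=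
  fun h' => h.not_reaches (((h.mem_iff w).1 hw).trans h')

theorem mem_of_arc (h : IsRepair r S W u u') (hv : v ∈ W) (hvw : (v, w) ∈ S) : w ∈ W :=
  (h.mem_iff w).2 (((h.mem_iff v).1 hv).tail hvw)

end IsRepair

/-- A walk from `v` to `r` in the underlying graph must leave the set of vertices that do not reach
`r`; symmetry of `A` orients the crossing edge as required. -/
theorem exists_isRepair [Fintype V] (hconn : (SimpleGraph.fromRel fun u v => (u, v) ∈ A).Connected)
    (hsymm : ∀ u v, (u, v) ∈ A → (v, u) ∈ A) (hv : ¬ Reaches S v r) :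
    ∃ W u u', IsRepair r S W u u' ∧ (u, u') ∈ A := by
  classical
  obtain ⟨q⟩ := hconn.preconnected v r
  obtain ⟨d, -, h1, h2⟩ := q.exists_boundary_dart {v | ¬ Reaches S v r} hv
    (by simpa using Reaches.refl S r)
  refine ⟨univ.filter (Reaches S d.fst), d.fst, d.snd,
    ⟨h1, by simpa using h2, fun w => by simp⟩, ?_⟩
  have h3 := d.adj
  rw [SimpleGraph.fromRel_adj] at h3
  exact h3.2.elim id (hsymm _ _)

variable [DecidableEq V]

/-- Reverses the arcs with both ends in `W`. -/
def reverseIn (W : Finset V) (a : V × V) : V × V := if a.1 ∈ W ∧ a.2 ∈ W then a.swap else a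

theorem reverseIn_of_mem (hv : v ∈ W) (hw : w ∈ W) : reverseIn W (v, w) = (w, v) := by
  simp [reverseIn, hv, hw]

theorem reverseIn_of_notMem_left (hv : v ∉ W) : reverseIn W (v, w) = (v, w) := by
  simp [reverseIn, hv]

theorem reverseIn_of_notMem_right (hw : w ∉ W) : reverseIn W (v, w) = (v, w) := by
  simp [reverseIn, hw]

theorem reverseIn_involutive (W : Finset V) : Function.Involutive (reverseIn W) := by
  rintro ⟨a, b⟩
  by_cases h : a ∈ W ∧ b ∈ W
  · rw [reverseIn_of_mem h.1 h.2, reverseIn_of_mem h.2 h.1]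
  · have : reverseIn W (a, b) = (a, b) := by simp [reverseIn, h]
    rw [this, this]

theorem mem_image_reverseIn {a : V × V} :
    a ∈ S.image (reverseIn W) ↔ reverseIn W a ∈ S := by
  rw [Finset.mem_image]
  constructor
  · rintro ⟨b, hb, rfl⟩
    rwa [reverseIn_involutive W b]
  · exact fun h => ⟨_, h, reverseIn_involutive W a⟩

theorem image_reverseIn_image : (S.image (reverseIn W)).image (reverseIn W) = S := by
  ext a
  rw [mem_image_reverseIn, mem_image_reverseIn, reverseIn_involutive W a]

namespace IsRepair

/-- Reversal opens no exit from the set of vertices that do not reach the root: vertices of `W` are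
in that set, and arcs with head off `W` are unchanged. -/
theorem not_reaches_of_arc (h : IsRepair r S W u u') (hv : ¬ Reaches S v r)
    (hvw : (v, w) ∈ S.image (reverseIn W)) :
    ¬ Reaches S w r := by
  rw [mem_image_reverseIn] at hvw
  by_cases hw : w ∈ W
  · exact h.not_reaches_of_mem hw
  · rw [reverseIn_of_notMem_right hw] at hvw
    exact fun h' => hv (Relation.ReflTransGen.head hvw h')

theorem arc_notMem (h : IsRepair r S W u u') : (u, u') ∉ S.image (reverseIn W) :=
  fun h' => h.not_reaches_of_arc h.not_reaches h' h.reaches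

/-- Vertices that reach the root lie off `W` and differ from `u`, so their arcs survive the
reversal. Avoiding `u` as a tail is what makes the path usable when the repair is undone. -/
theorem path_to_root (h : IsRepair r S W u u') (hv : Reaches S v r) :
    Relation.ReflTransGen (fun a b => (a, b) ∈ S.image (reverseIn W) ∧ a ≠ u) v r := by
  induction hv using Relation.ReflTransGen.head_induction_on with
  | refl => exact Relation.ReflTransGen.refl
  | head hab hb ih =>
    rename_i a b
    have ha : Reaches S a r := Relation.ReflTransGen.head hab hb
    refine Relation.ReflTransGen.head ⟨?_, fun hau => h.not_reaches (hau ▸ ha)⟩ ih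
    rw [mem_image_reverseIn, reverseIn_of_notMem_left]
    · exact hab
    · exact fun haW => h.not_reaches_of_mem haW ha

/-- Every vertex of `W` reaches `x` without leaving `W`, so after reversal `x` reaches all of `W`,
and still nothing leaves `W`. Thus `W` can be read off the reversed graph. -/
theorem mem_iff_reaches [Fintype V] (h : IsRepair r S W u u') (hC : IsUniqueCluster r S C)
    (hx : x ∈ C) :
    w ∈ W ↔ Reaches (S.image (reverseIn W)) x w := by
  have hxW : x ∈ W := (h.mem_iff x).2 (hC.reaches hx h.not_reaches)
  constructor
  · intro hw
    have hwx := hC.reaches hx (h.not_reaches_of_mem hw)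
    revert hw
    induction hwx using Relation.ReflTransGen.head_induction_on with
    | refl => exact fun _ => Relation.ReflTransGen.refl
    | head hab hb ih =>
      intro haW
      have hbW := h.mem_of_arc haW hab
      refine (ih hbW).tail ?_
      rw [mem_image_reverseIn, reverseIn_of_mem hbW haW]
      exact hab
  · intro hxw
    induction hxw with
    | refl => exact hxW
    | tail _ hab ih =>
      rename_i a b
      by_contra hb
      rw [mem_image_reverseIn, reverseIn_of_notMem_right hb] at hab
      exact hb (h.mem_of_arc ih hab)

/-- Reversal turns the paths from `u` to the vertices of `W` into paths to `u`. A vertex that does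
not reach the root heads for the cluster, enters `W` on the way, and then goes through `u → u'`. -/
theorem rootConnected [Fintype V] (h : IsRepair r S W u u') (hC : IsUniqueCluster r S C) :
    RootConnected r (insert (u, u') (S.image (reverseIn W))) := by
  obtain ⟨x, hx⟩ := hC.1.1.1
  have hxW : x ∈ W := (h.mem_iff x).2 (hC.reaches hx h.not_reaches)
  have hmono : ∀ {a b}, Reaches (S.image (reverseIn W)) a b →
      Reaches (insert (u, u') (S.image (reverseIn W))) a b := fun hab =>
    Relation.ReflTransGen.mono (fun _ _ h => Finset.mem_insert_of_mem h) _ _ hab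
  have hroot : ∀ {v}, Reaches S v r → Reaches (insert (u, u') (S.image (reverseIn W))) v r :=
    fun hv => hmono (Relation.ReflTransGen.mono (fun _ _ h => h.1) _ _ (h.path_to_root hv))
  have hWu : ∀ w, Reaches S u w → Reaches (S.image (reverseIn W)) w u := by
    intro w hw
    induction hw with
    | refl => exact Relation.ReflTransGen.refl
    | tail ha hab ih =>
      have haW := (h.mem_iff _).2 ha
      refine Relation.ReflTransGen.head ?_ ih
      rw [mem_image_reverseIn, reverseIn_of_mem (h.mem_of_arc haW hab) haW]
      exact hab
  intro v
  by_cases hv : Reaches S v r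
  · exact hroot hv
  · have hvu : Reaches (S.image (reverseIn W)) v u := by
      have hvx := hC.reaches hx hv
      clear hv
      induction hvx using Relation.ReflTransGen.head_induction_on with
      | refl => exact hWu x ((h.mem_iff x).1 hxW)
      | head hab hb ih =>
        rename_i a b
        by_cases ha : a ∈ W
        · exact hWu a ((h.mem_iff a).1 ha)
        · refine Relation.ReflTransGen.head ?_ ih
          rw [mem_image_reverseIn, reverseIn_of_notMem_left ha]
          exact hab
    exact ((hmono hvu).tail (Finset.mem_insert_self _ _)).trans (hroot h.reaches)

end IsRepair

/-- The repair can be undone, given the tail of the new arc and a vertex of the unique minimal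
cluster. -/
theorem IsRepair.injective [Fintype V] {S₁ S₂ : Finset (V × V)} {W₁ W₂ C₁ C₂ : Finset V}
    {u₁ u₂ : V} (h₁ : IsRepair r S₁ W₁ u u₁) (h₂ : IsRepair r S₂ W₂ u u₂)
    (hC₁ : IsUniqueCluster r S₁ C₁) (hC₂ : IsUniqueCluster r S₂ C₂) (hx₁ : x ∈ C₁) (hx₂ : x ∈ C₂)
    (heq : insert (u, u₁) (S₁.image (reverseIn W₁)) = insert (u, u₂) (S₂.image (reverseIn W₂))) :
    S₁ = S₂ := by
  -- Otherwise `u → u₁` is an arc of the second reversed graph. Continued by the first graph's path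
  -- to the root, which never uses an arc out of `u`, it would escape from the vertices that do not
  -- reach the root in `S₂`.
  have hu : u₁ = u₂ := by
    by_contra hne
    have h3 : (u, u₁) ∈ S₂.image (reverseIn W₂) := by
      have := heq ▸ Finset.mem_insert_self (u, u₁) _
      rw [Finset.mem_insert] at this
      exact this.resolve_left fun h => hne (Prod.ext_iff.1 h).2
    have h4 : ∀ w, Relation.ReflTransGen
        (fun a b => (a, b) ∈ S₁.image (reverseIn W₁) ∧ a ≠ u) u₁ w → ¬ Reaches S₂ w r := by
      intro w hw
      induction hw with
      | refl => exact h₂.not_reaches_of_arc h₂.not_reaches h3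
      | tail _ hab ih =>
        refine h₂.not_reaches_of_arc ih ?_
        have := Finset.mem_insert_of_mem (b := (u, u₁)) hab.1
        rw [heq] at this
        rw [Finset.mem_insert] at this
        exact this.resolve_left fun h => hab.2 (Prod.ext_iff.1 h).1
    exact h4 r (h₁.path_to_root h₁.reaches) Relation.ReflTransGen.refl
  subst hu
  have h0 : S₁.image (reverseIn W₁) = S₂.image (reverseIn W₂) := by
    rw [← Finset.erase_insert h₁.arc_notMem, heq, Finset.erase_insert h₂.arc_notMem]
  have hW : W₁ = W₂ := by
    ext w
    rw [h₁.mem_iff_reaches hC₁ hx₁, h₂.mem_iff_reaches hC₂ hx₂, h0]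
  rw [← image_reverseIn_image (S := S₁) (W := W₁), h0, hW, image_reverseIn_image]

end Repair

/-! ### The weight of a repair, and the resulting count. -/

section RepairWeight

variable {V : Type*} [DecidableEq V] {S A : Finset (V × V)} {r : V} {W : Finset V}
  {p : V × V → Set.Ioo (0 : ℝ) 1}

theorem image_reverseIn_subset (hsymm : ∀ u v, (u, v) ∈ A → (v, u) ∈ A) (hS : S ⊆ A) :
    S.image (reverseIn W) ⊆ A := by
  rintro ⟨a, b⟩ h
  rw [mem_image_reverseIn] at h
  have := hS h
  unfold reverseIn at this
  split_ifs at this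
  · exact hsymm _ _ this
  · exact this

/-- Reversal within `W` permutes `A` and preserves failure probabilities, so it permutes the factors
for the present and for the absent arcs. -/
theorem drawArcs_image_reverseIn (hsymm : ∀ u v, (u, v) ∈ A → (v, u) ∈ A ∧ p (v, u) = p (u, v))
    (hS : S ⊆ A) : drawArcs p A (S.image (reverseIn W)) = drawArcs p A S := by
  have hsymm' : ∀ u v, (u, v) ∈ A → (v, u) ∈ A := fun u v h => (hsymm u v h).1
  have hinj := (reverseIn_involutive W).injective
  have hp : ∀ a ∈ A, p (reverseIn W a) = p a := by
    rintro ⟨a, b⟩ hab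
    unfold reverseIn
    split_ifs
    · exact (hsymm a b hab).2
    · rfl
  have hA : A.image (reverseIn W) = A := by
    refine Finset.Subset.antisymm (image_reverseIn_subset hsymm' Subset.rfl) fun a ha => ?_
    rw [mem_image_reverseIn]
    exact image_reverseIn_subset (W := W) hsymm' Subset.rfl (Finset.mem_image_of_mem _ ha)
  rw [drawArcs_apply_of_subset hS, drawArcs_apply_of_subset (image_reverseIn_subset hsymm' hS)]
  have hsd : A \ S.image (reverseIn W) = (A \ S).image (reverseIn W) := by
    rw [Finset.image_sdiff _ _ hinj, hA]
  rw [hsd, Finset.prod_image (fun _ _ _ _ h => hinj h),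
    Finset.prod_image (fun _ _ _ _ h => hinj h)]
  congr 1
  · exact Finset.prod_congr rfl fun a ha => by rw [hp a (hS ha)]
  · exact Finset.prod_congr rfl fun a ha => by rw [hp a (Finset.mem_sdiff.1 ha).1]

theorem drawArcs_insert_mul {a : V × V} (ha : a ∈ A) (haS : a ∉ S) (hS : S ⊆ A) :
    drawArcs p A (insert a S) * ENNReal.ofReal (p a : ℝ) =
      drawArcs p A S * ENNReal.ofReal (1 - (p a : ℝ)) := by
  rw [drawArcs_apply_of_subset hS, drawArcs_apply_of_subset (Finset.insert_subset ha hS),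
    Finset.prod_insert haS, ← Finset.mul_prod_erase (A \ S) _ (Finset.mem_sdiff.2 ⟨ha, haS⟩),
    Finset.sdiff_insert]
  ring

/-- If `ρ` bounds the odds of failure, then adding an arc divides the probability by `ρ` at
most. -/
theorem drawArcs_le_mul_drawArcs_insert {ρ : ℝ≥0∞} {a : V × V} (ha : a ∈ A) (haS : a ∉ S)
    (hS : S ⊆ A) (hρ : ENNReal.ofReal (p a : ℝ) ≤ ρ * ENNReal.ofReal (1 - (p a : ℝ))) :
    drawArcs p A S ≤ ρ * drawArcs p A (insert a S) := by
  have h0 : ENNReal.ofReal (1 - (p a : ℝ)) ≠ 0 := by simpa using (p a).2.2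
  rw [← ENNReal.mul_le_mul_iff_left h0 ENNReal.ofReal_ne_top, ← drawArcs_insert_mul ha haS hS]
  calc _ ≤ drawArcs p A (insert a S) * (ρ * ENNReal.ofReal (1 - (p a : ℝ))) := by gcongr
    _ = _ := by ring

/-- On connected symmetric graphs, the mean number of arcs out of the unique minimal cluster, over
the outcomes that have one, is at most `ρ * m * n` times the probability of having none. -/
theorem sum_card_outArcs_mul_le [Fintype V] {ρ : ℝ≥0∞}
    (hconn : (SimpleGraph.fromRel fun u v => (u, v) ∈ A).Connected)
    (hsymm : ∀ u v, (u, v) ∈ A → (v, u) ∈ A ∧ p (v, u) = p (u, v))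
    (hρ : ∀ a ∈ A, ENNReal.ofReal (p a : ℝ) ≤ ρ * ENNReal.ofReal (1 - (p a : ℝ))) :
    ∑ C, ((outArcs A C).card : ℝ≥0∞) * resampleExp p A (fun S => indic (IsUniqueCluster r S C)) ∅ ≤
      ρ * A.card * Fintype.card V * resampleExp p A (fun S => indic (RootConnected r S)) ∅ := by
  classical
  have hsymm' : ∀ u v, (u, v) ∈ A → (v, u) ∈ A := fun u v h => (hsymm u v h).1
  -- The out-arcs are counted by marking one. The tail of the marked arc is also the vertex of the
  -- cluster needed to undo the repair, so no further factor is lost.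
  set Q : Finset (Finset V × Finset (V × V) × (V × V)) :=
    (univ ×ˢ A.powerset ×ˢ A).filter fun q => IsUniqueCluster r q.2.1 q.1 ∧ q.2.2.1 ∈ q.1 with hQ
  have hmem : ∀ q, q ∈ Q ↔ (q.2.1 ⊆ A ∧ q.2.2 ∈ A) ∧
      IsUniqueCluster r q.2.1 q.1 ∧ q.2.2.1 ∈ q.1 := by
    intro q
    simp [hQ]
  have hleft : ∑ C, ((outArcs A C).card : ℝ≥0∞) *
      resampleExp p A (fun S => indic (IsUniqueCluster r S C)) ∅ =
      ∑ q ∈ Q, drawArcs p A q.2.1 := by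
    rw [hQ, Finset.sum_filter, Finset.sum_product]
    refine Finset.sum_congr rfl fun C _ => ?_
    rw [Finset.sum_product, resampleExp, Finset.mul_sum]
    refine Finset.sum_congr rfl fun T _ => ?_
    rw [outArcs, Finset.card_filter, Nat.cast_sum, Finset.sum_mul]
    refine Finset.sum_congr rfl fun e _ => ?_
    by_cases h1 : e.1 ∈ C <;> by_cases h2 : IsUniqueCluster r T C <;> simp [h1, h2, indic]
  have hright : ρ * A.card * Fintype.card V *
      resampleExp p A (fun S => indic (RootConnected r S)) ∅ =
      ∑ y ∈ (A.powerset.filter (RootConnected r)) ×ˢ A ×ˢ (univ : Finset V),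
        ρ * drawArcs p A y.1 := by
    rw [Finset.sum_product, resampleExp, Finset.sum_filter, Finset.mul_sum]
    refine Finset.sum_congr rfl fun T _ => ?_
    by_cases h : RootConnected r T
    · simp [h, indic]
      ring
    · simp [h, indic]
  have hrep : ∀ q ∈ Q, ∃ y : Finset (V × V) × (V × V) × V, ∃ W u', y.2.1 = q.2.2 ∧
      IsRepair r q.2.1 W y.2.2 u' ∧ (y.2.2, u') ∈ A ∧
      y.1 = insert (y.2.2, u') (q.2.1.image (reverseIn W)) := by
    intro q hq
    obtain ⟨-, hu, hx⟩ := (hmem q).1 hq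
    have hnr : ¬ Reaches q.2.1 q.2.2.1 r := by
      intro hreach
      have : ∀ w, Reaches q.2.1 q.2.2.1 w → w ∈ q.1 := by
        intro w hw
        induction hw with
        | refl => exact hx
        | tail _ hab ih => exact hu.1.1.2.2 _ _ hab ih
      exact hu.1.1.2.1 (this r hreach)
    obtain ⟨W, u, u', h1, h2⟩ := exists_isRepair hconn hsymm' hnr
    exact ⟨(insert (u, u') (q.2.1.image (reverseIn W)), q.2.2, u), W, u', rfl, h1, h2, rfl⟩
  have : Nonempty (Finset (V × V) × (V × V) × V) := ⟨∅, (r, r), r⟩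
  choose! g hg using hrep
  have hinj : Set.InjOn g Q := by
    intro q hq q' hq' heq
    obtain ⟨W, u, h1, h2, -, h4⟩ := hg q hq
    obtain ⟨W', u', h1', h2', -, h4'⟩ := hg q' hq'
    obtain ⟨-, hu, hx⟩ := (hmem q).1 hq
    obtain ⟨-, hu', hx'⟩ := (hmem q').1 hq'
    rw [heq] at h1 h2 h4
    have he : q.2.2 = q'.2.2 := h1.symm.trans h1'
    have hS : q.2.1 = q'.2.1 := by
      rw [← he] at hx'
      exact h2.injective h2' hu hu' hx hx' (h4.symm.trans h4')
    have hC : q.1 = q'.1 := by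
      rw [hS] at hu
      exact hu'.2 _ hu.1
    exact Prod.ext hC (Prod.ext hS he)
  rw [hleft, hright]
  calc ∑ q ∈ Q, drawArcs p A q.2.1 ≤ ∑ q ∈ Q, ρ * drawArcs p A (g q).1 := by
        refine Finset.sum_le_sum fun q hq => ?_
        obtain ⟨W, u, -, h2, h3, h4⟩ := hg q hq
        have hqA := ((hmem q).1 hq).1.1
        rw [h4, ← drawArcs_image_reverseIn (W := W) hsymm hqA]
        exact drawArcs_le_mul_drawArcs_insert h3 h2.arc_notMem
          (image_reverseIn_subset hsymm' hqA) (hρ _ h3)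
    _ = ∑ y ∈ Q.image g, ρ * drawArcs p A y.1 :=
        (Finset.sum_image (f := fun y => ρ * drawArcs p A y.1) hinj).symm
    _ ≤ _ := by
        refine Finset.sum_le_sum_of_subset fun y hy => ?_
        obtain ⟨q, hq, rfl⟩ := Finset.mem_image.1 hy
        obtain ⟨W, u, h1, h2, h3, h4⟩ := hg q hq
        obtain ⟨⟨hqA, hqe⟩, hu, -⟩ := (hmem q).1 hq
        simp only [mem_product, mem_filter, mem_powerset, mem_univ, and_true]
        refine ⟨⟨?_, ?_⟩, h1 ▸ hqe⟩
        · rw [h4]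
          exact Finset.insert_subset h3 (image_reverseIn_subset hsymm' hqA)
        · rw [h4]
          exact h2.rootConnected hu

end RepairWeight

/-! ### Low-link invariants of the search stack. -/

section Search

variable {V : Type*}

/-- The index of every vertex on the stack `s` is its height. -/
def Ranked (idx : V → Option ℕ) : List V → Prop
  | [] => True
  | w :: s => idx w = some (s.length + 1) ∧ Ranked idx s

namespace Ranked

variable {idx idx' : V → Option ℕ} {s t : List V} {v w : V}

theorem of_append (h : Ranked idx (t ++ s)) : Ranked idx s := by
  induction t with
  | nil => exact h
  | cons a t ih => exact ih h.2

theorem index_le (h : Ranked idx s) (hw : w ∈ s) : ∃ k, idx w = some k ∧ k ≤ s.length := by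
  induction s with
  | nil => simp at hw
  | cons a s ih =>
    rw [List.mem_cons] at hw
    rcases hw with rfl | hw
    · exact ⟨_, h.1, by simp⟩
    · obtain ⟨k, h1, h2⟩ := ih h.2 hw
      exact ⟨k, h1, by simp; omega⟩

theorem index_gt (h : Ranked idx (t ++ s)) (hw : w ∈ t) :
    ∃ k, idx w = some k ∧ s.length < k := by
  induction t with
  | nil => simp at hw
  | cons a t ih =>
    rw [List.mem_cons] at hw
    rcases hw with rfl | hw
    · exact ⟨_, h.1, by simp⟩
    · exact ih h.2 hw

theorem notMem_right (h : Ranked idx (t ++ s)) (hw : w ∈ t) : w ∉ s := by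
  intro hs
  obtain ⟨k, h1, h2⟩ := h.index_gt hw
  obtain ⟨k', h3, h4⟩ := h.of_append.index_le hs
  rw [h1, Option.some_inj] at h3
  omega

theorem index_mid (h : Ranked idx (t ++ v :: s)) : idx v = some (s.length + 1) :=
  h.of_append.1

theorem notMem_left_mid (h : Ranked idx (t ++ v :: s)) : v ∉ t := fun hv =>
  h.notMem_right hv (by simp)

theorem notMem_tail (h : Ranked idx (v :: s)) : v ∉ s :=
  notMem_right (t := [v]) h (by simp)

theorem notMem_right_mid (h : Ranked idx (t ++ v :: s)) : v ∉ s := h.of_append.notMem_tail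

theorem notMem_right_of_mem (h : Ranked idx (t ++ v :: s)) (hw : w ∈ t ++ [v]) : w ∉ s := by
  rw [← List.singleton_append, ← List.append_assoc] at h
  exact h.notMem_right hw

theorem nodup (h : Ranked idx s) : s.Nodup := by
  induction s with
  | nil => simp
  | cons a s ih => exact List.nodup_cons.2 ⟨h.notMem_tail, ih h.2⟩

theorem congr (h : Ranked idx s) (hi : ∀ u ∈ s, idx' u = idx u) : Ranked idx' s := by
  induction s with
  | nil => trivial
  | cons a s ih =>
    exact ⟨(hi a (by simp)).trans h.1, ih h.2 fun u hu => hi u (by simp [hu])⟩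

end Ranked

/-- There is a path of `R` from `a` to `b` along which all vertices but the last satisfy `P`. -/
def Within (R : Finset (V × V)) (P : V → Prop) (a b : V) : Prop :=
  Relation.ReflTransGen (fun x y => (x, y) ∈ R ∧ P x) a b

theorem Within.mono {R : Finset (V × V)} {P Q : V → Prop} {a b : V} (h : Within R P a b)
    (hPQ : ∀ x, P x → Q x) : Within R Q a b :=
  Relation.ReflTransGen.mono (fun _ _ h => ⟨h.1, hPQ _ h.2⟩) _ _ h

theorem Within.refl (R : Finset (V × V)) (P : V → Prop) (a : V) : Within R P a a :=
  Relation.ReflTransGen.refl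

theorem Within.trans {R : Finset (V × V)} {P : V → Prop} {a b c : V} (h : Within R P a b)
    (h' : Within R P b c) : Within R P a c :=
  Relation.ReflTransGen.trans h h'

theorem Within.head {R : Finset (V × V)} {P : V → Prop} {a b c : V} (hab : (a, b) ∈ R) (ha : P a)
    (h' : Within R P b c) : Within R P a c :=
  Relation.ReflTransGen.head ⟨hab, ha⟩ h'

theorem Within.congr {R R' : Finset (V × V)} {P : V → Prop} {a b : V} (h : Within R P a b)
    (hR : ∀ x, P x → ∀ y, (x, y) ∈ R' ↔ (x, y) ∈ R) : Within R' P a b :=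
  Relation.ReflTransGen.mono (fun x y h => ⟨(hR x h.2 y).2 h.1, h.2⟩) _ _ h

/-- The state of the search from `v` after the out-neighbours of `v` have been examined, except for
those in `ws`: the stack is `t ++ v :: s`, and `m` is the root of `v`. -/
structure Explored (R : Finset (V × V)) (idx : V → Option ℕ) (m : ℕ) (s : List V) (v : V)
    (t ws : List V) : Prop where
  low : ∃ y ∈ v :: s, idx y = some m ∧ Within R (· ∈ t ++ [v]) v y
  arcs : ∀ x ∈ t ++ [v], ∀ w, (x, w) ∈ R →
    (x = v ∧ w ∈ ws) ∨ w ∈ t ++ [v] ∨ (w ∈ s ∧ ∃ k, idx w = some k ∧ m ≤ k)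
  down : ∀ x ∈ t, Within R (· ∈ t ++ [v]) v x
  up : ∀ x ∈ t, ∃ y ∈ v :: s, Within R (· ∈ t ++ [v]) x y

namespace Explored

variable {R R' : Finset (V × V)} {idx idx' : V → Option ℕ} {m k : ℕ} {s t ws : List V} {v w r : V}

theorem congr (h : Explored R idx m s v t ws) (hi : ∀ u ∈ v :: s, idx' u = idx u)
    (hR : ∀ u ∈ t ++ [v], ∀ w, (u, w) ∈ R' ↔ (u, w) ∈ R) : Explored R' idx' m s v t ws where
  low := by
    obtain ⟨y, h1, h2, h3⟩ := h.low
    exact ⟨y, h1, (hi y h1).trans h2, h3.congr hR⟩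
  arcs x hx w hw := by
    obtain h1 | h1 | ⟨h1, h2⟩ := h.arcs x hx w ((hR x hx w).1 hw)
    · exact Or.inl h1
    · exact Or.inr (Or.inl h1)
    · exact Or.inr (Or.inr ⟨h1, by rwa [hi w (List.mem_cons_of_mem _ h1)]⟩)
  down x hx := (h.down x hx).congr hR
  up x hx := by
    obtain ⟨y, h1, h2⟩ := h.up x hx
    exact ⟨y, h1, h2.congr hR⟩

theorem start (hidx : idx v = some m) (hws : ∀ w, (v, w) ∈ R → w ∈ ws) :
    Explored R idx m s v [] ws where
  low := ⟨v, by simp, hidx, Within.refl _ _ _⟩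
  arcs x hx w hw := by
    obtain rfl : x = v := by simpa using hx
    exact Or.inl ⟨rfl, hws w hw⟩
  down x hx := by simp at hx
  up x hx := by simp at hx

theorem skip (h : Explored R idx m s v t (w :: ws)) (hw : (v, w) ∉ R) :
    Explored R idx m s v t ws where
  low := h.low
  arcs x hx y hy := by
    obtain ⟨rfl, h1⟩ | h1 := h.arcs x hx y hy
    · rw [List.mem_cons] at h1
      rcases h1 with rfl | h1
      · exact absurd hy hw
      · exact Or.inl ⟨rfl, h1⟩
    · exact Or.inr h1
  down := h.down
  up := h.up

theorem root_le (h : Explored R idx m s v t ws) (hr : Ranked idx (t ++ v :: s)) :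
    m ≤ s.length + 1 := by
  obtain ⟨y, h1, h2, -⟩ := h.low
  obtain ⟨k, h3, h4⟩ := hr.of_append.index_le h1
  rw [h2, Option.some_inj] at h3
  simpa [h3] using h4

/-- The arc `v → w` leads to a vertex that is on the stack already. -/
theorem back (h : Explored R idx m s v t (w :: ws)) (hr : Ranked idx (t ++ v :: s))
    (hw : (v, w) ∈ R) (hk : idx w = some k) (hws : w ∈ t ++ v :: s) :
    Explored R idx (min m k) s v t ws where
  low := by
    rcases le_or_gt m k with hmk | hmk
    · rw [min_eq_left hmk]
      exact h.low
    · rw [min_eq_right hmk.le]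
      refine ⟨w, ?_, hk, Within.head hw (by simp) (Within.refl _ _ _)⟩
      rw [List.mem_append] at hws
      -- A vertex above `v` has an index greater than that of `v`, hence than `m`, and cannot lower
      -- the root.
      refine hws.resolve_left fun hwt => ?_
      obtain ⟨k', h1, h2⟩ := hr.index_gt hwt
      rw [hk, Option.some_inj] at h1
      have := h.root_le hr
      simp at h2
      omega
  arcs x hx y hy := by
    obtain ⟨rfl, h1⟩ | h1 | ⟨h1, k', h2, h3⟩ := h.arcs x hx y hy
    · rw [List.mem_cons] at h1
      rcases h1 with rfl | h1
      · right
        have : y ∈ t ++ [x] ∨ y ∈ s := by simpa [or_assoc] using hws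
        exact this.imp id fun h => ⟨h, k, hk, min_le_right _ _⟩
      · exact Or.inl ⟨rfl, h1⟩
    · exact Or.inr (Or.inl h1)
    · exact Or.inr (Or.inr ⟨h1, k', h2, (min_le_left _ _).trans h3⟩)
  down := h.down
  up := h.up

/-- If the root of `v` is lower than `v`, then `v` and all vertices above it reach lower ones. -/
theorem reaches_lower (h : Explored R idx m s v t ws) (hr : Ranked idx (t ++ v :: s))
    (hm : m ≤ s.length) {x : V} (hx : x ∈ t ++ [v]) : ∃ y ∈ s, Within R (· ∈ t ++ [v]) x y := by
  obtain ⟨y, h1, h2, h3⟩ := h.low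
  have hy : y ∈ s := by
    rw [List.mem_cons] at h1
    refine h1.resolve_left fun hyv => ?_
    rw [hyv, hr.index_mid, Option.some_inj] at h2
    omega
  rw [List.mem_append, List.mem_singleton] at hx
  rcases hx with hx | rfl
  · obtain ⟨z, h4, h5⟩ := h.up x hx
    rw [List.mem_cons] at h4
    rcases h4 with rfl | h4
    · exact ⟨y, hy, h5.trans h3⟩
    · exact ⟨z, h4, h5⟩
  · exact ⟨y, hy, h3⟩

/-- The search from `v` returns to the search from `u`. -/
theorem join {s t ws : List V} {u : V} {m₂ : ℕ} {t₂ : List V}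
    (h : Explored R idx m s u t (v :: ws)) (huv : (u, v) ∈ R)
    (h₂ : Explored R idx m₂ (t ++ u :: s) v t₂ [])
    (hr : Ranked idx (t₂ ++ v :: (t ++ u :: s))) (hm₂ : m₂ ≤ (t ++ u :: s).length) :
    Explored R idx (min m m₂) s u (t₂ ++ v :: t) ws := by
  have hr' : Ranked idx (t ++ u :: s) := by
    rw [← List.singleton_append, ← List.append_assoc] at hr
    exact hr.of_append
  have hsub : ∀ x, x ∈ t ++ [u] → x ∈ (t₂ ++ v :: t) ++ [u] := by simp; tauto
  have hsub₂ : ∀ x, x ∈ t₂ ++ [v] → x ∈ (t₂ ++ v :: t) ++ [u] := by simp; tauto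
  have hu : u ∈ (t₂ ++ v :: t) ++ [u] := by simp
  constructor
  · rcases le_or_gt m m₂ with hle | hlt
    · rw [min_eq_left hle]
      obtain ⟨y, h1, h3, h4⟩ := h.low
      exact ⟨y, h1, h3, h4.mono hsub⟩
    · rw [min_eq_right hlt.le]
      obtain ⟨y, h1, h3, h4⟩ := h₂.low
      refine ⟨y, ?_, h3, Within.head huv hu (h4.mono hsub₂)⟩
      rw [List.mem_cons] at h1
      rcases h1 with rfl | h1
      · rw [hr.index_mid, Option.some_inj] at h3
        omega
      · rw [List.mem_append] at h1
        refine h1.resolve_left fun hyt => ?_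
        obtain ⟨k, h5, h6⟩ := hr'.index_gt hyt
        rw [h3, Option.some_inj] at h5
        have := h.root_le hr'
        simp at h6
        omega
  · intro x hx w hw
    have hx' : x ∈ t₂ ++ [v] ∨ x ∈ t ++ [u] := by simpa [or_assoc] using hx
    rcases hx' with hx' | hx'
    · obtain ⟨-, h1⟩ | h1 | ⟨h1, k, h3, h4⟩ := h₂.arcs x hx' w hw
      · simp at h1
      · exact Or.inr (Or.inl (hsub₂ w h1))
      · have : w ∈ t ++ [u] ∨ w ∈ s := by simpa [or_assoc] using h1
        rcases this with h5 | h5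
        · exact Or.inr (Or.inl (hsub w h5))
        · exact Or.inr (Or.inr ⟨h5, k, h3, (min_le_right _ _).trans h4⟩)
    · obtain ⟨rfl, h1⟩ | h1 | ⟨h1, k, h3, h4⟩ := h.arcs x hx' w hw
      · rw [List.mem_cons] at h1
        rcases h1 with rfl | h1
        · exact Or.inr (Or.inl (by simp))
        · exact Or.inl ⟨rfl, h1⟩
      · exact Or.inr (Or.inl (hsub w h1))
      · exact Or.inr (Or.inr ⟨h1, k, h3, (min_le_left _ _).trans h4⟩)
  · intro x hx
    rw [List.mem_append, List.mem_cons] at hx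
    rcases hx with hx | rfl | hx
    · exact Within.head huv hu ((h₂.down x hx).mono hsub₂)
    · exact Within.head huv hu (Within.refl _ _ _)
    · exact (h.down x hx).mono hsub
  · intro x hx
    have hx' : x ∈ t₂ ++ [v] ∨ x ∈ t := by simpa [or_assoc] using hx
    rcases hx' with hx' | hx'
    · obtain ⟨y, h1, h3⟩ := h₂.reaches_lower hr hm₂ hx'
      rw [List.mem_append] at h1
      rcases h1 with h1 | h1
      · obtain ⟨z, h4, h5⟩ := h.up y h1
        exact ⟨z, h4, (h3.mono hsub₂).trans (h5.mono hsub)⟩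
      · exact ⟨y, h1, h3.mono hsub₂⟩
    · obtain ⟨z, h4, h5⟩ := h.up x hx'
      exact ⟨z, h4, h5.mono hsub⟩

/-- If `v` is its own root when its search ends, then `v` and the vertices above it form a minimal
cluster. -/
theorem isMinimalCluster [DecidableEq V] (h : Explored R idx m s v t [])
    (hr : Ranked idx (t ++ v :: s)) (hm : s.length < m) (hrs : r ∈ s) :
    IsMinimalCluster r R (t ++ [v]).toFinset := by
  -- An arc into `s` would lead to an index at least `m`, but the indices on `s` are at most
  -- `s.length < m`.
  have hclosed : ∀ x ∈ t ++ [v], ∀ w, (x, w) ∈ R → w ∈ t ++ [v] := by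
    intro x hx w hw
    obtain ⟨-, h1⟩ | h1 | ⟨h1, k, h2, h3⟩ := h.arcs x hx w hw
    · simp at h1
    · exact h1
    · obtain ⟨k', h4, h5⟩ := (hr.of_append.2).index_le h1
      rw [h2, Option.some_inj] at h4
      omega
  have hpath : ∀ {x y}, x ∈ t ++ [v] → Within R (· ∈ t ++ [v]) x y → y ∈ t ++ [v] := by
    intro x y hx hxy
    induction hxy with
    | refl => exact hx
    | tail _ hab ih => exact hclosed _ ih _ hab.1
  have hv : v ∈ t ++ [v] := by simp
  refine ⟨⟨⟨v, by simp⟩, fun h' => hr.notMem_right_of_mem (List.mem_toFinset.1 h') hrs, ?_⟩, ?_⟩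
  · intro x w hxw hx
    rw [List.mem_toFinset] at hx ⊢
    exact hclosed x hx w hxw
  -- Since nothing leaves the set, `up` leads every vertex to `v`, and `down` leads from `v` to
  -- every vertex; so any cluster inside is the whole set.
  · intro C hC hle
    have hCpath : ∀ {x y}, x ∈ C → Within R (· ∈ t ++ [v]) x y → y ∈ C := by
      intro x y hx hxy
      induction hxy with
      | refl => exact hx
      | tail _ hab ih => exact hC.2.2 _ _ hab.1 ih
    obtain ⟨x, hx⟩ := hC.1
    have hvC : v ∈ C := by
      have hx' := List.mem_toFinset.1 (hle hx)
      have hx'' := hx'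
      rw [List.mem_append, List.mem_singleton] at hx''
      rcases hx'' with hxt | rfl
      · obtain ⟨y, h1, h2⟩ := h.up x hxt
        have h3 := hpath hx' h2
        rw [List.mem_cons] at h1
        rcases h1 with rfl | h1
        · exact hCpath hx h2
        · exact absurd h1 (hr.notMem_right_of_mem h3)
      · exact hx
    intro y hy
    rw [List.mem_toFinset, List.mem_append, List.mem_singleton] at hy
    rcases hy with hy | rfl
    · exact hCpath hvC (h.down y hy)
    · exact hvC

end Explored

/-- `K` is what remains to be done after a pending call of the search from `v`, made when the stack
was `s`. -/
inductive Suspended (r : V) (R : Finset (V × V)) (idx root : V → Option ℕ) :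
    V → List V → List (DFSTask V) → Prop
  | main {v : V} {s l : List V} (root_mem : r ∈ s) (reach : ∀ x ∈ s, Within R (· ∈ s) x r)
      (cover : ∀ w, w ∈ l ∨ w ∈ s) : Suspended r R idx root v s [DFSTask.main l]
  | call {s : List V} {u : V} {t : List V} {v : V} {ws : List V} {K : List (DFSTask V)} {m : ℕ}
      (hroot : root u = some m) (explored : Explored R idx m s u t (v :: ws)) (arc : (u, v) ∈ R)
      (rest : Suspended r R idx root u s K) :
      Suspended r R idx root v (t ++ u :: s) (DFSTask.join u v :: DFSTask.scan u ws :: K)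

namespace Suspended

variable {r : V} {R R' : Finset (V × V)} {idx idx' root root' : V → Option ℕ} {v : V} {s : List V}
  {K : List (DFSTask V)}

/-- Suspended calls refer only to vertices on the stack, so popping vertices above `s` and redrawing
their arcs does not disturb them. -/
theorem congr (h : Suspended r R idx root v s K) (hi : ∀ u ∈ s, idx' u = idx u)
    (hr : ∀ u ∈ s, root' u = root u) (hR : ∀ u ∈ s, ∀ w, (u, w) ∈ R' ↔ (u, w) ∈ R) :
    Suspended r R' idx' root' v s K := by
  induction h with
  | main h1 h2 h3 => exact main h1 (fun x hx => (h2 x hx).congr hR) h3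
  | call h1 h2 h3 _ ih =>
    refine call ?_ (h2.congr ?_ ?_) ((hR _ (by simp) _).2 h3) (ih ?_ ?_ ?_)
    · exact (hr _ (by simp)).trans h1
    · exact fun w hw => hi w (by simp at hw ⊢; tauto)
    · exact fun w hw => hR w (by simp at hw ⊢; tauto)
    · exact fun w hw => hi w (by simp at hw ⊢; tauto)
    · exact fun w hw => hr w (by simp at hw ⊢; tauto)
    · exact fun w hw => hR w (by simp at hw ⊢; tauto)

theorem root_mem_stack (h : Suspended r R idx root v s K) : r ∈ s := by
  induction h with
  | main h1 _ _ => exact h1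
  | call _ _ _ _ ih => simp [ih]

/-- A search that returns without popping has a root below its start, so all its vertices reach
older ones, and through these `r`. -/
theorem return_to_main {t l : List V} {w : V} {m : ℕ}
    (h : Suspended r R idx root v s [DFSTask.main l]) (he : Explored R idx m s v t [])
    (hr : Ranked idx (t ++ v :: s)) (hm : m ≤ s.length) :
    Suspended r R idx root w (t ++ v :: s) [DFSTask.main l] := by
  cases h with
  | main h1 h2 h3 =>
    refine main (by simp [h1]) ?_ fun w => (h3 w).imp id fun h => by simp [h]
    intro x hx
    have hx' : x ∈ t ++ [v] ∨ x ∈ s := by simpa [or_assoc] using hx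
    have hs : ∀ y ∈ s, Within R (· ∈ t ++ v :: s) y r := fun y hy =>
      (h2 y hy).mono fun z hz => by simp [hz]
    rcases hx' with hx' | hx'
    · obtain ⟨y, h4, h5⟩ := he.reaches_lower hr hm hx'
      refine (h5.mono fun z hz => ?_).trans (hs y h4)
      simp at hz ⊢
      tauto
    · exact hs x hx'

end Suspended

end Search

/-! ### The invariant and the potential of the search, step by step. -/

section Machine

variable {V : Type*} {A : Finset (V × V)}

/-- What remains to be done when the next task does not depend on the arcs out of the vertices off
the stack. -/
inductive Idle (L : AdjacencyList A) (r : V) (R : Finset (V × V)) (idx root : V → Option ℕ) :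
    List V → List (DFSTask V) → Prop
  | init {vs : List V} (nodup : vs.Nodup) :
      Idle L r R idx root [] [DFSTask.init vs, DFSTask.setRoot, DFSTask.main L.verts]
  | dfs {s : List V} {v : V} {K : List (DFSTask V)} (rest : Suspended r R idx root v s K)
      (notMem : v ∉ s) : Idle L r R idx root s (DFSTask.dfs v :: K)
  | pop {s : List V} {v : V} {t : List V} {K : List (DFSTask V)}
      (rest : Suspended r R idx root v s K) :
      Idle L r R idx root (t ++ v :: s) (DFSTask.pop v :: DFSTask.dfs v :: K)

theorem Idle.congr {L : AdjacencyList A} {r : V} {R R' : Finset (V × V)}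
    {idx idx' root root' : V → Option ℕ} {s : List V} {K : List (DFSTask V)}
    (h : Idle L r R idx root s K)
    (hi : ∀ u ∈ s, idx' u = idx u) (hr : ∀ u ∈ s, root' u = root u)
    (hR : ∀ u ∈ s, ∀ w, (u, w) ∈ R' ↔ (u, w) ∈ R) : Idle L r R' idx' root' s K := by
  cases h with
  | init h => exact Idle.init h
  | dfs h1 h2 => exact Idle.dfs (h1.congr hi hr hR) h2
  | pop h1 =>
    refine Idle.pop (h1.congr ?_ ?_ ?_)
    · exact fun w hw => hi w (by simp [hw])
    · exact fun w hw => hr w (by simp [hw])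
    · exact fun w hw => hR w (by simp [hw])

/-- One unit, unless a vertex is about to be visited. -/
def topCost : List (DFSTask V) → ℕ
  -- The unit released here pays for the step of the main loop that calls the search without
  -- shortening its list; the visit puts it back.
  | DFSTask.dfs _ :: _ => 0
  | _ => 1

theorem topCost_le_one (K : List (DFSTask V)) : topCost K ≤ 1 := by
  unfold topCost
  split <;> simp

variable [DecidableEq V]

/-- The part of the list `s` up to and including `v`. -/
def upTo (v : V) : List V → List V
  | [] => []
  | w :: s => if w = v then [w] else w :: upTo v s

theorem upTo_append {v : V} {s t : List V} (hv : v ∉ t) : upTo v (t ++ v :: s) = t ++ [v] := by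
  induction t with
  | nil => simp [upTo]
  | cons a t ih =>
    rw [List.mem_cons, not_or] at hv
    simp [upTo, Ne.symm hv.1, ih hv.2]

/-- The arcs that are about to be redrawn. -/
def pendingArcs (A : Finset (V × V)) (s : List V) : List (DFSTask V) → Finset (V × V)
  | DFSTask.redraw w xs :: K => xs.toFinset.image (fun x => (w, x)) ∪ pendingArcs A s K
  | DFSTask.init vs :: _ => outArcs A vs.toFinset
  | DFSTask.pop v :: _ => outArcs A (upTo v s).toFinset
  | _ => ∅

theorem image_out (L : AdjacencyList A) (v : V) :
    (L.out v).toFinset.image (fun x => (v, x)) = outArcs A {v} := by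
  ext ⟨a, b⟩
  simp only [mem_image, List.mem_toFinset, L.mem_out, Prod.mk.injEq, mem_outArcs, mem_singleton]
  grind

theorem outArcs_cons (v : V) (vs : List V) :
    outArcs A {v} ∪ outArcs A vs.toFinset = outArcs A (v :: vs).toFinset := by
  ext a
  simp [mem_outArcs]
  tauto

/-- The possible stages of the dynamic depth-first search. -/
inductive Stage (L : AdjacencyList A) (r : V) (R : Finset (V × V)) (idx root : V → Option ℕ) :
    List V → List (DFSTask V) → Prop
  | idle {s : List V} {K : List (DFSTask V)} (idle : Idle L r R idx root s K) :
      Stage L r R idx root s K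
  | redraw {w : V} {xs s : List V} {K : List (DFSTask V)} (idle : Idle L r R idx root s K)
      (notMem : w ∉ s) (nodup : xs.Nodup) (mem_out : ∀ x ∈ xs, (w, x) ∈ A)
      (notMem_pending : ∀ x, (w, x) ∉ pendingArcs A s K) :
      Stage L r R idx root s (DFSTask.redraw w xs :: K)
  | setRoot : Stage L r R idx root [] [DFSTask.setRoot, DFSTask.main L.verts]
  | main {v : V} {s l : List V} (rest : Suspended r R idx root v s [DFSTask.main l]) :
      Stage L r R idx root s [DFSTask.main l]
  | scan {s : List V} {v : V} {t ws : List V} {K : List (DFSTask V)} {m : ℕ}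
      (hroot : root v = some m) (explored : Explored R idx m s v t ws)
      (rest : Suspended r R idx root v s K) :
      Stage L r R idx root (t ++ v :: s) (DFSTask.scan v ws :: K)
  | join {s : List V} {v : V} {t : List V} {u : V} {ws : List V} {K : List (DFSTask V)} {m : ℕ}
      (hroot : root v = some m) (explored : Explored R idx m s v t []) (lower : m ≤ s.length)
      (rest : Suspended r R idx root v s (DFSTask.join u v :: DFSTask.scan u ws :: K)) :
      Stage L r R idx root (t ++ v :: s) (DFSTask.join u v :: DFSTask.scan u ws :: K)
  | done {s : List V} (connected : RootConnected r R) : Stage L r R idx root s []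

/-- The invariant of the dynamic depth-first search. -/
structure DFSInvariant (L : AdjacencyList A) (r : V) (c : DFSState V) : Prop where
  subset : c.R ⊆ A
  ranked : Ranked c.index c.stack
  unvisited : ∀ v, v ∉ c.stack → c.index v = none
  next_eq : c.next = c.stack.length + 1
  stage : Stage L r c.R c.index c.root c.stack c.tasks

/-- An upper bound for the number of steps that a task takes, apart from those paid for by visiting
a vertex. -/
def DFSTask.cost (L : AdjacencyList A) (s : List V) : DFSTask V → ℕ
  | DFSTask.init vs => 1 + (vs.map fun v => 2 + (L.out v).length).sum
  | DFSTask.setRoot => 1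
  | DFSTask.main l => 1 + l.length
  | DFSTask.dfs _ => 0
  -- Each arc pays for its examination and a possible join; the extra unit is the final test.
  | DFSTask.scan _ ws => 1 + 2 * ws.length
  | DFSTask.join _ _ => 1
  -- Per vertex: one step for the pop, `1 + deg` for the redraw, and `3 + 2 * deg` for becoming
  -- unvisited again.
  | DFSTask.pop v => ((upTo v s).map fun w => 5 + 3 * (L.out w).length).sum
  | DFSTask.redraw _ xs => 1 + xs.length

/-- Only a pop has a cost that depends on the stack, and none is pending among suspended calls. -/
theorem Suspended.sum_cost_eq {L : AdjacencyList A} {r : V} {R : Finset (V × V)}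
    {idx root : V → Option ℕ} {v : V} {s : List V} {K : List (DFSTask V)}
    (h : Suspended r R idx root v s K) (s₁ s₂ : List V) :
    (K.map (DFSTask.cost L s₁)).sum = (K.map (DFSTask.cost L s₂)).sum := by
  induction h with
  | main => rfl
  | call _ _ _ _ ih => simp [DFSTask.cost, ih]

variable [Fintype V]

/-- An upper bound for the number of steps before the next cluster is popped. -/
def potential (L : AdjacencyList A) (idx : V → Option ℕ) (s : List V) (K : List (DFSTask V)) : ℕ :=
  -- A visit takes one step, creates a scan of cost `1 + 2 * deg`, and restores the unit of
  -- `topCost`.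
  (∑ v with idx v = none, (3 + 2 * (L.out v).length)) + (K.map (DFSTask.cost L s)).sum + topCost K

variable {L : AdjacencyList A} {idx : V → Option ℕ} {f : V → ℕ} {v : V}

theorem sum_unvisited_update_some (h : idx v = none) (n : ℕ) :
    (∑ w with Function.update idx v (some n) w = none, f w) + f v = ∑ w with idx w = none, f w := by
  have : (univ.filter fun w => Function.update idx v (some n) w = none) =
      (univ.filter fun w => idx w = none).erase v := by
    ext w
    by_cases hw : w = v
    · subst hw; simp
    · simp [hw]
  rw [this, Finset.sum_erase_add]
  simpa using h

theorem sum_unvisited_update_none {n : ℕ} (h : idx v = some n) :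
    (∑ w with Function.update idx v none w = none, f w) = (∑ w with idx w = none, f w) + f v := by
  have : (univ.filter fun w => Function.update idx v none w = none) =
      insert v (univ.filter fun w => idx w = none) := by
    ext w
    by_cases hw : w = v
    · subst hw; simp
    · simp [hw]
  rw [this, Finset.sum_insert, add_comm]
  simp [h]

/-- The cost of popping a cluster: the steps until its vertices have been visited again. -/
def clusterCost (L : AdjacencyList A) (C : Finset V) : ℕ := ∑ w ∈ C, (5 + 3 * (L.out w).length)

/-- The possible effects of a step on the arcs, the pending arcs, and the potential. -/
inductive StepEffect (L : AdjacencyList A) (r : V) (p : V × V → Set.Ioo (0 : ℝ) 1)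
    (c : DFSState V) : Prop
  | halt (step : dfsStep L r p c = PMF.pure (Sum.inr c.R)) (connected : RootConnected r c.R)
      (pending : pendingArcs A c.stack c.tasks = ∅)
      (pos : 1 ≤ potential L c.index c.stack c.tasks)
  | move (c' : DFSState V) (step : dfsStep L r p c = PMF.pure (Sum.inl c'))
      (invariant : DFSInvariant L r c') (arcs : c'.R = c.R)
      (pending : pendingArcs A c'.stack c'.tasks = pendingArcs A c.stack c.tasks)
      (drop : potential L c'.index c'.stack c'.tasks + 1 ≤ potential L c.index c.stack c.tasks)
  | popCluster (c' : DFSState V) (C : Finset V) (step : dfsStep L r p c = PMF.pure (Sum.inl c'))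
      (invariant : DFSInvariant L r c') (arcs : c'.R = c.R)
      (minimal : IsMinimalCluster r c.R C)
      (pending : pendingArcs A c.stack c.tasks = ∅)
      (pending' : pendingArcs A c'.stack c'.tasks = outArcs A C)
      (drop : potential L c'.index c'.stack c'.tasks + 1 ≤
        potential L c.index c.stack c.tasks + clusterCost L C)
  | draw (a : V × V) (K : List (DFSTask V))
      (step : dfsStep L r p c =
        (resample p {a} c.R).map fun R' => Sum.inl { c with R := R', tasks := K })
      (invariant : ∀ T ⊆ {a}, DFSInvariant L r { c with R := c.R \ {a} ∪ T, tasks := K })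
      (notMem : a ∉ pendingArcs A c.stack K)
      (pending : pendingArcs A c.stack c.tasks = insert a (pendingArcs A c.stack K))
      (drop : potential L c.index c.stack K + 1 ≤ potential L c.index c.stack c.tasks)

variable {r : V} {p : V × V → Set.Ioo (0 : ℝ) 1} {R : Finset (V × V)} {root : V → Option ℕ}
  {next : ℕ} {stack : List V}

theorem stepEffect_done {s : List V} (hR : RootConnected r R) :
    StepEffect L r p ⟨R, idx, root, next, s, []⟩ :=
  StepEffect.halt rfl hR rfl (by simp [potential, topCost])

theorem stepEffect_init {vs : List V}
    (h : DFSInvariant L r ⟨R, idx, root, next, [],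
      [DFSTask.init vs, DFSTask.setRoot, DFSTask.main L.verts]⟩) (hvs : vs.Nodup) :
    StepEffect L r p ⟨R, idx, root, next, [],
      [DFSTask.init vs, DFSTask.setRoot, DFSTask.main L.verts]⟩ := by
  have hidx : ∀ v, idx v = none := fun v => h.unvisited v (by simp)
  cases vs with
  | nil =>
    refine StepEffect.move _ rfl ⟨h.subset, h.ranked, h.unvisited, h.next_eq, Stage.setRoot⟩ rfl
      ?_ ?_
    · simp [pendingArcs, outArcs]
    · simp [potential, topCost, DFSTask.cost]
  | cons v vs =>
    rw [List.nodup_cons] at hvs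
    have hupd : Function.update idx v none = idx := by
      rw [Function.update_eq_self_iff, hidx]
    refine StepEffect.move _ rfl ⟨h.subset, trivial, ?_, h.next_eq,
      Stage.redraw (Idle.init hvs.2) (by simp) (L.out_nodup v) ?_ ?_⟩ rfl ?_ ?_
    · intro w _
      dsimp only
      rw [hupd, hidx]
    · exact fun x hx => (L.mem_out v x).1 hx
    · intro x hx
      simp only [pendingArcs, mem_outArcs, List.mem_toFinset] at hx
      exact hvs.1 hx.2
    · simp only [pendingArcs]
      rw [image_out, outArcs_cons]
    · dsimp only
      rw [hupd]
      simp [potential, topCost, DFSTask.cost]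
      omega

theorem stepEffect_setRoot
    (h : DFSInvariant L r ⟨R, idx, root, next, [], [DFSTask.setRoot, DFSTask.main L.verts]⟩) :
    StepEffect L r p ⟨R, idx, root, next, [], [DFSTask.setRoot, DFSTask.main L.verts]⟩ := by
  have hidx : ∀ v, idx v = none := fun v => h.unvisited v (by simp)
  refine StepEffect.move _ rfl ⟨h.subset, ⟨by simp, trivial⟩, ?_, rfl,
      Stage.main (Suspended.main (v := r) (by simp) ?_ fun v => Or.inl (L.mem_verts v))⟩ rfl rfl ?_
  · intro v hv
    dsimp only at hv ⊢
    rw [Function.update_of_ne (by simpa using hv), hidx]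
  · intro x hx
    obtain rfl : x = r := by simpa using hx
    exact Within.refl _ _ _
  · have := sum_unvisited_update_some (f := fun v => 3 + 2 * (L.out v).length) (hidx r) 1
    simp [potential, topCost, DFSTask.cost]
    omega

theorem stepEffect_main {l : List V} {v : V}
    (h : DFSInvariant L r ⟨R, idx, root, next, stack, [DFSTask.main l]⟩)
    (hs : Suspended r R idx root v stack [DFSTask.main l]) :
    StepEffect L r p ⟨R, idx, root, next, stack, [DFSTask.main l]⟩ := by
  cases l with
  | nil =>
    refine StepEffect.move _ rfl ⟨h.subset, h.ranked, h.unvisited, h.next_eq, Stage.done ?_⟩ rfl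
      rfl ?_
    · cases hs with
      | main h1 h2 h3 =>
        intro v
        exact Relation.ReflTransGen.mono (fun _ _ h => h.1) _ _
          (h2 v ((h3 v).resolve_left (by simp)))
    · simp [potential, topCost, DFSTask.cost]
  | cons v vs =>
    by_cases hv : idx v = none
    · refine StepEffect.move ⟨R, idx, root, next, stack, [DFSTask.dfs v, DFSTask.main (v :: vs)]⟩
        (by simp [dfsStep, hv]) ⟨h.subset, h.ranked, h.unvisited, h.next_eq,
          Stage.idle (Idle.dfs ?_ fun hvs => ?_)⟩ rfl rfl ?_
      · cases hs with
        | main h1 h2 h3 => exact Suspended.main h1 h2 h3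
      · obtain ⟨k, hk, -⟩ := h.ranked.index_le hvs
        dsimp only at hk
        rw [hv] at hk
        cases hk
      · simp [potential, topCost, DFSTask.cost]
    · refine StepEffect.move ⟨R, idx, root, next, stack, [DFSTask.main vs]⟩
        (by simp [dfsStep, hv]) ⟨h.subset, h.ranked, h.unvisited, h.next_eq,
          Stage.main (v := v) ?_⟩ rfl rfl ?_
      · cases hs with
        | main h1 h2 h3 =>
          refine Suspended.main h1 h2 fun w => ?_
          rcases h3 w with h4 | h4
          · rw [List.mem_cons] at h4
            rcases h4 with rfl | h4
            · right
              by_contra hcon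
              exact hv (h.unvisited w hcon)
            · exact Or.inl h4
          · exact Or.inr h4
      · simp [potential, topCost, DFSTask.cost]

theorem stepEffect_dfs {K : List (DFSTask V)}
    (h : DFSInvariant L r ⟨R, idx, root, next, stack, DFSTask.dfs v :: K⟩)
    (hs : Suspended r R idx root v stack K) (hv : v ∉ stack) :
    StepEffect L r p ⟨R, idx, root, next, stack, DFSTask.dfs v :: K⟩ := by
  have hne : ∀ u ∈ stack, u ≠ v := fun u hu huv => hv (huv ▸ hu)
  have hnext : next = stack.length + 1 := h.next_eq
  refine StepEffect.move _ rfl ⟨h.subset, ⟨?_, ?_⟩, ?_, ?_,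
    Stage.scan (t := []) (s := stack) (m := next) ?_ (Explored.start ?_ fun w hw => ?_)
      (hs.congr ?_ ?_ fun _ _ _ => Iff.rfl)⟩ rfl rfl ?_
  · simp [hnext]
  · exact h.ranked.congr fun u hu => Function.update_of_ne (hne u hu) _ _
  · intro w hw
    simp only [List.mem_cons, not_or] at hw
    dsimp only
    rw [Function.update_of_ne hw.1]
    exact h.unvisited w hw.2
  · simp [hnext]
  · simp
  · simp
  · exact (L.mem_out v w).2 (h.subset hw)
  · exact fun u hu => Function.update_of_ne (hne u hu) _ _
  · exact fun u hu => Function.update_of_ne (hne u hu) _ _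
  · have := sum_unvisited_update_some (f := fun v => 3 + 2 * (L.out v).length)
      (h.unvisited v hv) next
    dsimp only at this
    simp [potential, topCost, DFSTask.cost]
    rw [hs.sum_cost_eq (v :: stack) stack]
    omega

theorem stepEffect_scan_cons {s t ws : List V} {w : V} {K : List (DFSTask V)} {m : ℕ}
    (h : DFSInvariant L r ⟨R, idx, root, next, t ++ v :: s, DFSTask.scan v (w :: ws) :: K⟩)
    (hroot : root v = some m) (he : Explored R idx m s v t (w :: ws))
    (hs : Suspended r R idx root v s K) :
    StepEffect L r p ⟨R, idx, root, next, t ++ v :: s, DFSTask.scan v (w :: ws) :: K⟩ := by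
  have hrk : Ranked idx (t ++ v :: s) := h.ranked
  by_cases hR : (v, w) ∈ R
  · cases hw : idx w with
    | none =>
      refine StepEffect.move ⟨R, idx, root, next, t ++ v :: s,
          DFSTask.dfs w :: DFSTask.join v w :: DFSTask.scan v ws :: K⟩
        (by simp [dfsStep, hR, hw]) ⟨h.subset, hrk, h.unvisited, h.next_eq,
          Stage.idle (Idle.dfs (Suspended.call hroot he hR hs) fun hws => ?_)⟩ rfl rfl ?_
      · obtain ⟨k, hk, -⟩ := hrk.index_le hws
        rw [hw] at hk
        cases hk
      · simp [potential, topCost, DFSTask.cost]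
        omega
    | some k =>
      refine StepEffect.move ⟨R, idx, Function.update root v (some (min m k)), next, t ++ v :: s,
          DFSTask.scan v ws :: K⟩
        (by simp [dfsStep, hR, hw, hroot]) ⟨h.subset, hrk, h.unvisited, h.next_eq,
          Stage.scan (by simp) (he.back hrk hR hw ?_)
            (hs.congr (fun _ _ => rfl) ?_ fun _ _ _ => Iff.rfl)⟩ rfl rfl ?_
      · by_contra hcon
        have := h.unvisited w hcon
        dsimp only at this
        rw [hw] at this
        cases this
      · intro u hu
        refine Function.update_of_ne ?_ _ _
        rintro rfl
        exact hrk.notMem_right_mid hu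
      · simp [potential, topCost, DFSTask.cost]
  · refine StepEffect.move ⟨R, idx, root, next, t ++ v :: s, DFSTask.scan v ws :: K⟩
      (by simp [dfsStep, hR]) ⟨h.subset, hrk, h.unvisited, h.next_eq,
        Stage.scan hroot (he.skip hR) hs⟩ rfl rfl ?_
    simp [potential, topCost, DFSTask.cost]

/-- Since `m ≤ s.length + 1`, with equality exactly when `v` is its own root, either a minimal
cluster has been found or the root lies strictly lower and the call returns. -/
theorem stepEffect_scan_nil {s t : List V} {K : List (DFSTask V)} {m : ℕ}
    (h : DFSInvariant L r ⟨R, idx, root, next, t ++ v :: s, DFSTask.scan v [] :: K⟩)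
    (hroot : root v = some m) (he : Explored R idx m s v t [])
    (hs : Suspended r R idx root v s K) :
    StepEffect L r p ⟨R, idx, root, next, t ++ v :: s, DFSTask.scan v [] :: K⟩ := by
  have hrk : Ranked idx (t ++ v :: s) := h.ranked
  have hle := he.root_le hrk
  by_cases hm : m = s.length + 1
  · refine StepEffect.popCluster ⟨R, idx, root, next, t ++ v :: s,
        DFSTask.pop v :: DFSTask.dfs v :: K⟩ (t ++ [v]).toFinset
      (by simp [dfsStep, hroot, hrk.index_mid, hm]) ⟨h.subset, hrk, h.unvisited, h.next_eq,
        Stage.idle (Idle.pop hs)⟩ rfl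
      (he.isMinimalCluster hrk (by omega) hs.root_mem_stack) rfl ?_ ?_
    · rw [pendingArcs, upTo_append hrk.notMem_left_mid]
    · have hnd : (t ++ [v]).Nodup := by
        have : Ranked idx ((t ++ [v]) ++ s) := by simpa using hrk
        exact (List.nodup_append.1 this.nodup).1
      rw [clusterCost, List.sum_toFinset _ hnd]
      simp only [potential, topCost, DFSTask.cost, List.map_cons, List.sum_cons,
        upTo_append hrk.notMem_left_mid, List.length_nil]
      omega
  · refine StepEffect.move ⟨R, idx, root, next, t ++ v :: s, K⟩
      (by simp [dfsStep, hroot, hrk.index_mid, hm]) ⟨h.subset, hrk, h.unvisited, h.next_eq, ?_⟩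
      rfl ?_ ?_
    · cases hs with
      | main h1 h2 h3 =>
        exact Stage.main (v := v)
          ((Suspended.main (v := v) h1 h2 h3).return_to_main he hrk (by omega))
      | call h1 h2 h3 h4 => exact Stage.join hroot he (by omega) (Suspended.call h1 h2 h3 h4)
    · cases hs <;> rfl
    · have := topCost_le_one K
      have h0 : topCost (DFSTask.scan v [] :: K) = 1 := rfl
      simp [potential, h0, DFSTask.cost]
      omega

theorem stepEffect_join {s t ws : List V} {u : V} {K : List (DFSTask V)} {m : ℕ}
    (h : DFSInvariant L r
      ⟨R, idx, root, next, t ++ v :: s, DFSTask.join u v :: DFSTask.scan u ws :: K⟩)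
    (hroot : root v = some m) (he : Explored R idx m s v t []) (hm : m ≤ s.length)
    (hs : Suspended r R idx root v s (DFSTask.join u v :: DFSTask.scan u ws :: K)) :
    StepEffect L r p
      ⟨R, idx, root, next, t ++ v :: s, DFSTask.join u v :: DFSTask.scan u ws :: K⟩ := by
  have hrk : Ranked idx (t ++ v :: s) := h.ranked
  cases hs with
  | @call s₁ _ t₁ _ _ _ m₁ h1 h2 h3 h4 =>
    have heq : t ++ v :: (t₁ ++ u :: s₁) = (t ++ v :: t₁) ++ u :: s₁ := by simp
    have hrk' := hrk
    rw [heq] at hrk'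
    refine StepEffect.move ⟨R, idx, Function.update root u (some (min m₁ m)), next,
        t ++ v :: (t₁ ++ u :: s₁), DFSTask.scan u ws :: K⟩
      (by simp [dfsStep, hroot, h1]) ⟨h.subset, hrk, h.unvisited, h.next_eq, ?_⟩ rfl rfl ?_
    · dsimp only
      rw [heq]
      refine Stage.scan (by simp) (h2.join h3 he hrk hm)
        (h4.congr (fun _ _ => rfl) ?_ fun _ _ _ => Iff.rfl)
      intro x hx
      refine Function.update_of_ne ?_ _ _
      rintro rfl
      exact hrk'.notMem_right_mid hx
    · simp [potential, topCost, DFSTask.cost]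

/-- A pop only hands the arcs of the top vertex from the pending pop to a pending redraw, so the set
of arcs still to be drawn stays the same. -/
theorem stepEffect_pop {s t : List V} {K : List (DFSTask V)}
    (h : DFSInvariant L r
      ⟨R, idx, root, next, t ++ v :: s, DFSTask.pop v :: DFSTask.dfs v :: K⟩)
    (hs : Suspended r R idx root v s K) :
    StepEffect L r p ⟨R, idx, root, next, t ++ v :: s, DFSTask.pop v :: DFSTask.dfs v :: K⟩ := by
  have hrk : Ranked idx (t ++ v :: s) := h.ranked
  have hnext : next = (t ++ v :: s).length + 1 := h.next_eq
  -- the effect of popping `w` on the memory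
  have hpop : ∀ {w : V} {s' : List V}, t ++ v :: s = w :: s' →
      Ranked (Function.update idx w none) s' ∧
      (∀ u, u ∉ s' → Function.update idx w none u = none) ∧ next - 1 = s'.length + 1 ∧
      (∀ u ∈ s', u ≠ w) ∧ ∃ k, idx w = some k := by
    intro w s' heq
    rw [heq] at hrk hnext
    have hne : ∀ u ∈ s', u ≠ w := fun u hu huw => hrk.notMem_tail (huw ▸ hu)
    refine ⟨hrk.2.congr fun u hu => Function.update_of_ne (hne u hu) _ _, ?_, ?_, hne, _, hrk.1⟩
    · intro u hu
      by_cases huw : u = w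
      · rw [huw, Function.update_self]
      · rw [Function.update_of_ne huw]
        refine h.unvisited u ?_
        dsimp only
        rw [heq, List.mem_cons, not_or]
        exact ⟨huw, hu⟩
    · simp [hnext]
  have hmem_out : ∀ w, ∀ x ∈ L.out w, (w, x) ∈ A := fun w x hx => (L.mem_out w x).1 hx
  cases t with
  | nil =>
    obtain ⟨h1, h2, h3, h4, k, hk⟩ := hpop (w := v) (s' := s) rfl
    refine StepEffect.move ⟨R, Function.update idx v none, Function.update root v none, next - 1,
        s, DFSTask.redraw v (L.out v) :: DFSTask.dfs v :: K⟩
      (by simp [dfsStep]) ⟨h.subset, h1, h2, h3, Stage.redraw (Idle.dfs (hs.congr ?_ ?_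
        fun _ _ _ => Iff.rfl) hrk.notMem_tail) hrk.notMem_tail (L.out_nodup v) (hmem_out v) ?_⟩
      rfl ?_ ?_
    · exact fun u hu => Function.update_of_ne (h4 u hu) _ _
    · exact fun u hu => Function.update_of_ne (h4 u hu) _ _
    · simp [pendingArcs]
    · simp [pendingArcs, image_out, upTo]
    · have := sum_unvisited_update_none (f := fun v => 3 + 2 * (L.out v).length) hk
      simp [potential, topCost, DFSTask.cost, upTo]
      rw [hs.sum_cost_eq s (v :: s), this]
      omega
  | cons w t =>
    obtain ⟨h1, h2, h3, h4, k, hk⟩ := hpop (w := w) (s' := t ++ v :: s) rfl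
    have hwv : w ≠ v := fun hwv => hrk.notMem_left_mid (by simp [hwv])
    have hvt : v ∉ t := fun hv => hrk.notMem_left_mid (by simp [hv])
    have hws : w ∉ t ++ v :: s := Ranked.notMem_tail hrk
    refine StepEffect.move ⟨R, Function.update idx w none, Function.update root w none, next - 1,
        t ++ v :: s, DFSTask.redraw w (L.out w) :: DFSTask.pop v :: DFSTask.dfs v :: K⟩
      (by simp [dfsStep, hwv]) ⟨h.subset, h1, h2, h3, Stage.redraw (Idle.pop (hs.congr ?_ ?_
        fun _ _ _ => Iff.rfl)) hws (L.out_nodup w) (hmem_out w) ?_⟩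
      rfl ?_ ?_
    · exact fun u hu => Function.update_of_ne (h4 u (by simp [hu])) _ _
    · exact fun u hu => Function.update_of_ne (h4 u (by simp [hu])) _ _
    · intro x hx
      rw [pendingArcs, upTo_append hvt, mem_outArcs, List.mem_toFinset] at hx
      refine hws ?_
      have := hx.2
      simp only [List.mem_append, List.mem_cons] at this ⊢
      tauto
    · simp only [pendingArcs, List.cons_append, upTo, hwv, if_false]
      rw [image_out, outArcs_cons]
    · have := sum_unvisited_update_none (f := fun v => 3 + 2 * (L.out v).length) hk
      simp [potential, topCost, DFSTask.cost, upTo, hwv]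
      rw [hs.sum_cost_eq (t ++ v :: s) (w :: (t ++ v :: s)), this]
      omega

/-- The arc drawn has its tail off the stack, so the invariant survives either outcome; and it is
not pending again, so it is drawn once per pop. -/
theorem stepEffect_redraw {w : V} {xs : List V} {K : List (DFSTask V)}
    (h : DFSInvariant L r ⟨R, idx, root, next, stack, DFSTask.redraw w xs :: K⟩)
    (hi : Idle L r R idx root stack K) (hw : w ∉ stack) (hnd : xs.Nodup)
    (hmem : ∀ x ∈ xs, (w, x) ∈ A) (hpend : ∀ x, (w, x) ∉ pendingArcs A stack K) :
    StepEffect L r p ⟨R, idx, root, next, stack, DFSTask.redraw w xs :: K⟩ := by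
  cases xs with
  | nil =>
    refine StepEffect.move _ rfl ⟨h.subset, h.ranked, h.unvisited, h.next_eq, Stage.idle hi⟩ rfl
      ?_ ?_
    · simp [pendingArcs]
    · have := topCost_le_one K
      have h0 : topCost (DFSTask.redraw w [] :: K) = 1 := rfl
      simp [potential, h0, DFSTask.cost]
      omega
  | cons x xs =>
    rw [List.nodup_cons] at hnd
    refine StepEffect.draw (w, x) (DFSTask.redraw w xs :: K) rfl ?_ ?_ ?_ ?_
    · intro T hT
      refine ⟨?_, h.ranked, h.unvisited, h.next_eq, Stage.redraw (hi.congr (fun _ _ => rfl)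
        (fun _ _ => rfl) fun u hu y => ?_) hw hnd.2 (fun y hy => hmem y (by simp [hy])) hpend⟩
      · refine subset_of_resampled h.subset ?_ hT
        rw [Finset.singleton_subset_iff]
        exact hmem x (by simp)
      · refine mem_resampled_iff hT ?_
        simp only [mem_singleton, Prod.mk.injEq, not_and]
        exact fun huw => absurd hu (huw ▸ hw)
    · simp only [pendingArcs, mem_union, mem_image, List.mem_toFinset, not_or]
      refine ⟨?_, hpend x⟩
      rintro ⟨y, hy, hyx⟩
      rw [Prod.mk.injEq] at hyx
      exact hnd.1 (hyx.2 ▸ hy)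
    · simp [pendingArcs]
    · simp [potential, topCost, DFSTask.cost]

theorem DFSInvariant.stepEffect {c : DFSState V} (h : DFSInvariant L r c) :
    StepEffect L r p c := by
  obtain ⟨R, idx, root, next, stack, tasks⟩ := c
  have hs : Stage L r R idx root stack tasks := h.stage
  cases hs with
  | idle hi =>
    cases hi with
    | init h1 => exact stepEffect_init h h1
    | dfs h1 h2 => exact stepEffect_dfs h h1 h2
    | pop h1 => exact stepEffect_pop h h1
  | redraw h1 h2 h3 h4 h5 => exact stepEffect_redraw h h1 h2 h3 h4 h5
  | setRoot => exact stepEffect_setRoot h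
  | main h1 => exact stepEffect_main h h1
  | @scan _ _ _ ws _ _ h1 h2 h3 =>
    cases ws with
    | nil => exact stepEffect_scan_nil h h1 h2 h3
    | cons => exact stepEffect_scan_cons h h1 h2 h3
  | join h1 h2 h3 h4 => exact stepEffect_join h h1 h2 h3 h4
  | done h1 => exact stepEffect_done h1

end Machine

/-! ### Output laws and expected running time. -/

section Assembly

variable {V : Type*} {A : Finset (V × V)} {L : AdjacencyList A} {r : V}
  {p : V × V → Set.Ioo (0 : ℝ) 1} {S : Finset (V × V)}

theorem rootConnected_of_connected (hconn : (SimpleGraph.fromRel fun u v => (u, v) ∈ A).Connected)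
    (hsymm : ∀ u v, (u, v) ∈ A → (v, u) ∈ A) (r : V) : RootConnected r A := by
  intro v
  obtain ⟨q⟩ := hconn.preconnected v r
  induction q with
  | nil => exact Relation.ReflTransGen.refl
  | cons h _ ih =>
    rw [SimpleGraph.fromRel_adj] at h
    exact Relation.ReflTransGen.head (h.2.elim id (hsymm _ _)) ih

theorem one_le_length_out (L : AdjacencyList A) (h : RootConnected r A) {w : V} (hw : w ≠ r) :
    1 ≤ (L.out w).length := by
  obtain hwr | ⟨x, hx, -⟩ := Relation.ReflTransGen.cases_head (h w)
  · exact absurd hwr hw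
  · exact List.length_pos_of_mem ((L.mem_out w x).2 hx)

variable [DecidableEq V]

theorem resampleExp_rootConnected_ne_zero (hA : RootConnected r A) :
    resampleExp p A (fun S => indic (RootConnected r S)) ∅ ≠ 0 := by
  intro h
  rw [resampleExp, Finset.sum_eq_zero_iff] at h
  have := h A (Finset.mem_powerset_self A)
  simp [indic, hA, drawArcs_ne_zero] at this

theorem resampleExp_indic_le_one (D S : Finset (V × V)) (P : Finset (V × V) → Prop) :
    resampleExp p D (fun S => indic (P S)) S ≤ 1 :=
  (resampleExp_mono (g := fun _ => 1) fun _ _ => indic_le_one _).trans_eq (resampleExp_const _ _ _)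

theorem clusterPopping_step_of_rootConnected (h : RootConnected r S) :
    (clusterPopping A r p).step S = PMF.pure (Sum.inr S) :=
  if_neg fun ⟨_, hC⟩ => not_isCluster_of_rootConnected h hC

/-- The mean of `f` at the arcs after the pending redraws. -/
noncomputable def pendingExp (A : Finset (V × V)) (p : V × V → Set.Ioo (0 : ℝ) 1)
    (f : Finset (V × V) → ℝ≥0∞) (c : DFSState V) : ℝ≥0∞ :=
  resampleExp p (pendingArcs A c.stack c.tasks) f c.R

/-- Drawing one pending arc carries out a part of the averaging that `pendingExp` already contains.
-/
theorem pendingExp_draw {a : V × V} {K : List (DFSTask V)} {c : DFSState V}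
    (f : Finset (V × V) → ℝ≥0∞) (h : a ∉ pendingArcs A c.stack K)
    (h' : pendingArcs A c.stack c.tasks = insert a (pendingArcs A c.stack K)) :
    resampleExp p {a} (fun R' => pendingExp A p f { c with R := R', tasks := K }) c.R =
      pendingExp A p f c := by
  rw [pendingExp, h', Finset.insert_eq, ← resampleExp_resampleExp (by simpa using h)]
  rfl

theorem dynamicDFS_init_expect (f : DFSState V → ℝ≥0∞) :
    (dynamicDFS L r p).init.expect f = f
      { R := ∅
        index := fun _ => none
        root := fun _ => none
        next := 1
        stack := []
        tasks := [DFSTask.init L.verts, DFSTask.setRoot, DFSTask.main L.verts] } :=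
  PMF.expect_pure _ _

theorem card_outArcs (L : AdjacencyList A) (C : Finset V) :
    (outArcs A C).card = ∑ w ∈ C, (L.out w).length := by
  rw [Finset.card_eq_sum_card_fiberwise (f := Prod.fst) (t := C)
    fun a ha => (mem_outArcs.1 ha).2]
  refine Finset.sum_congr rfl fun w hw => ?_
  have : (outArcs A C).filter (fun a => a.1 = w) = (L.out w).toFinset.image (fun x => (w, x)) := by
    rw [image_out]
    ext a
    simp only [mem_filter, mem_outArcs, mem_singleton]
    grind
  rw [this, Finset.card_image_of_injective _ (Prod.mk_right_injective w),
    List.toFinset_card_of_nodup (L.out_nodup w)]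

/-- Every vertex other than `r` has an arc out of it, so `5 + 3 * deg ≤ 8 * deg`. -/
theorem clusterCost_le (L : AdjacencyList A) (h : RootConnected r A) {C : Finset V} (hr : r ∉ C) :
    clusterCost L C ≤ 8 * (outArcs A C).card := by
  rw [card_outArcs L, clusterCost, Finset.mul_sum]
  refine Finset.sum_le_sum fun w hw => ?_
  have := one_le_length_out L h (w := w) fun hwr => hr (hwr ▸ hw)
  omega

variable [Fintype V]

/-- The bound on the mean cost is divided by the probability of root-connectedness, which is
positive because `A` itself may be drawn. -/
theorem resampleExp_popLimitCost_ne_top (hA : RootConnected r A) {κ : Finset V → ℝ≥0∞}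
    (hκ : ∀ C, κ C ≠ ∞) : resampleExp p A (popLimitCost A r p κ) ∅ ≠ ∞ := by
  intro h
  have h1 := resampleExp_popLimitCost_le (A := A) (r := r) (p := p) κ
  rw [h, ENNReal.mul_top (resampleExp_rootConnected_ne_zero hA), top_le_iff] at h1
  refine ENNReal.sum_ne_top.2 (fun C _ => ?_) h1
  exact ENNReal.mul_ne_top (hκ C)
    (ne_top_of_le_ne_top ENNReal.one_ne_top (resampleExp_indic_le_one _ _ _))

theorem resampleExp_popLimit_eq_zero (hA : ¬ RootConnected r A) (f : Finset (V × V) → ℝ≥0∞) :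
    resampleExp p A (popLimit A r p f) ∅ = 0 := by
  rw [resampleExp_congr (g := fun _ => 0), resampleExp_const]
  exact fun T hT => popLimit_eq_zero hA (by simpa using hT)

/-! ### Basic cluster-popping -/

/-- All minimal clusters of a family can be popped at once. -/
theorem popLimit_eq_resampleExp_biUnion {f : Finset (V × V) → ℝ≥0∞} (F : Finset (Finset V))
    (hF : ∀ C ∈ F, IsMinimalCluster r S C) :
    popLimit A r p f S = resampleExp p (outArcs A (F.biUnion id)) (popLimit A r p f) S := by
  induction F using Finset.induction_on with
  | empty => simp [outArcs, resampleExp_empty]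
  | insert C F hC ih =>
    have hd : Disjoint (F.biUnion id) C := by
      rw [Finset.disjoint_biUnion_left]
      exact fun C' hC' => (hF C' (Finset.mem_insert_of_mem hC')).disjoint
        (hF C (Finset.mem_insert_self _ _)) fun h => hC (h ▸ hC')
    have hout : outArcs A ((insert C F).biUnion id) =
        outArcs A (F.biUnion id) ∪ outArcs A C := by
      ext a
      simp only [mem_outArcs, Finset.biUnion_insert, mem_union, id]
      tauto
    rw [ih fun C' hC' => hF C' (Finset.mem_insert_of_mem hC'), hout,
      ← resampleExp_resampleExp (disjoint_outArcs A hd)]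
    refine resampleExp_congr fun T hT => popLimit_eq_resampleExp ?_
    exact (isMinimalCluster_resampled hT hd).2 (hF C (Finset.mem_insert_self _ _))

theorem popLimitCost_eq_resampleExp_biUnion (hA : RootConnected r A) (hS : S ⊆ A)
    (F : Finset (Finset V)) (hF : ∀ C ∈ F, IsMinimalCluster r S C) :
    popLimitCost A r p 1 S =
      resampleExp p (outArcs A (F.biUnion id)) (popLimitCost A r p 1) S + F.card := by
  induction F using Finset.induction_on with
  | empty => simp [outArcs, resampleExp_empty]
  | insert C F hC ih =>
    have hd : Disjoint (F.biUnion id) C := by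
      rw [Finset.disjoint_biUnion_left]
      exact fun C' hC' => (hF C' (Finset.mem_insert_of_mem hC')).disjoint
        (hF C (Finset.mem_insert_self _ _)) fun h => hC (h ▸ hC')
    have hout : outArcs A ((insert C F).biUnion id) =
        outArcs A (F.biUnion id) ∪ outArcs A C := by
      ext a
      simp only [mem_outArcs, Finset.biUnion_insert, mem_union, id]
      tauto
    have h1 : resampleExp p (outArcs A (F.biUnion id)) (popLimitCost A r p 1) S =
        resampleExp p (outArcs A (F.biUnion id))
          (fun S => resampleExp p (outArcs A C) (popLimitCost A r p 1) S + 1) S := by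
      refine resampleExp_congr fun T hT => ?_
      rw [popLimitCost_eq_resampleExp (C := C), popLimit_one_eq_one hA, mul_one]
      · rfl
      · exact subset_of_resampled hS (outArcs_subset _ _) hT
      · exact (isMinimalCluster_resampled hT hd).2 (hF C (Finset.mem_insert_self _ _))
    rw [ih fun C' hC' => hF C' (Finset.mem_insert_of_mem hC'), hout,
      ← resampleExp_resampleExp (disjoint_outArcs A hd), h1, resampleExp_add, resampleExp_const,
      Finset.card_insert_of_notMem hC, add_assoc]
    push_cast
    rw [add_comm (1 : ℝ≥0∞)]

open Classical in
theorem poppedArcs_eq :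
    poppedArcs A r S = outArcs A ((univ.filter (IsMinimalCluster r S)).biUnion id) := by
  ext a
  simp [poppedArcs, mem_outArcs]

theorem clusterPopping_step_of_not_rootConnected (h : ¬ RootConnected r S) :
    (clusterPopping A r p).step S = (resample p (poppedArcs A r S) S).map Sum.inl := by
  refine if_pos ?_
  by_contra hcon
  push Not at hcon
  exact h (rootConnected_of_forall_not_isCluster hcon)

theorem clusterPopping_isInvariant : (clusterPopping A r p).IsInvariant (· ⊆ A) := by
  constructor
  · intro S hS
    by_contra hcon
    exact hS (drawArcs_eq_zero hcon)
  · intro S S' hS hS'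
    by_cases h : RootConnected r S
    · rw [clusterPopping_step_of_rootConnected h] at hS'
      simp at hS'
    · rw [clusterPopping_step_of_not_rootConnected h, ← PMF.mem_support_iff,
        PMF.mem_support_map_iff] at hS'
      obtain ⟨S'', h1, h2⟩ := hS'
      obtain ⟨T, hT, rfl⟩ := mem_support_resample h1
      cases h2
      exact subset_of_resampled hS (poppedArcs_eq (A := A) ▸ outArcs_subset _ _) hT

theorem clusterPopping_expect_step (b : Finset (V × V)) :
    ((clusterPopping A r p).step S).expect
      (RandomLoop.withOutput (popLimit A r p fun S => indic (S = b)) b) =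
        popLimit A r p (fun S => indic (S = b)) S := by
  classical
  by_cases h : RootConnected r S
  · rw [clusterPopping_step_of_rootConnected h, PMF.expect_pure,
      popLimit_of_forall_not (rootConnected_iff.1 h)]
    rfl
  · rw [clusterPopping_step_of_not_rootConnected h, PMF.expect_map, expect_resample, poppedArcs_eq]
    refine (popLimit_eq_resampleExp_biUnion _ ?_).symm
    simp

/-- Every iteration but the halting one pops at least one minimal cluster, so the iterations are at
most one more than the pops. -/
theorem clusterPopping_expectedSteps_ne_top (hA : RootConnected r A) :
    (clusterPopping A r p).expectedSteps ≠ ∞ := by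
  classical
  refine ne_top_of_le_ne_top ?_ (RandomLoop.expectedSteps_le clusterPopping_isInvariant
    (fun S => 1 + popLimitCost A r p 1 S) fun S hS => ?_)
  · change (drawArcs p A).expect _ ≠ ∞
    rw [expect_drawArcs_eq_resampleExp, resampleExp_add, resampleExp_const]
    exact ENNReal.add_ne_top.2 ⟨ENNReal.one_ne_top,
      resampleExp_popLimitCost_ne_top hA fun _ => ENNReal.one_ne_top⟩
  · gcongr
    by_cases h : RootConnected r S
    · rw [clusterPopping_step_of_rootConnected h, PMF.expect_pure]
      exact zero_le
    · rw [clusterPopping_step_of_not_rootConnected h, PMF.expect_map, expect_resample,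
        poppedArcs_eq, popLimitCost_eq_resampleExp_biUnion hA hS
          (univ.filter (IsMinimalCluster r S)) (by simp)]
      simp only [Sum.elim_inl]
      rw [resampleExp_add, resampleExp_const, add_comm]
      gcongr
      rw [rootConnected_iff] at h
      push Not at h
      obtain ⟨C, hC⟩ := h
      have : 1 ≤ (univ.filter (IsMinimalCluster r S)).card :=
        Finset.card_pos.2 ⟨C, by simpa using hC⟩
      exact_mod_cast this

theorem clusterPopping_outputLaw (b : Finset (V × V)) :
    (clusterPopping A r p).outputLaw b =
      resampleExp p A (popLimit A r p fun S => indic (S = b)) ∅ := by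
  rw [← expect_drawArcs_eq_resampleExp]
  by_cases hA : RootConnected r A
  · refine RandomLoop.outputLaw_eq clusterPopping_isInvariant _ b
      (fun S _ => clusterPopping_expect_step b) (fun S _ => ?_)
      (clusterPopping_expectedSteps_ne_top hA)
    exact (popLimit_mono (fun S => indic_le_one _) S).trans (popLimit_one_le_one S)
  · have h1 := RandomLoop.outputLaw_le (clusterPopping_isInvariant (A := A) (r := r) (p := p)) _ b
      fun S _ => clusterPopping_expect_step b
    change _ ≤ (drawArcs p A).expect _ at h1
    rw [expect_drawArcs_eq_resampleExp, resampleExp_popLimit_eq_zero hA] at h1 ⊢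
    exact le_antisymm h1 zero_le

theorem clusterPopping_tsum_outputLaw (hA : RootConnected r A) :
    ∑' S, (clusterPopping A r p).outputLaw S = 1 := by
  rw [tsum_fintype, Finset.sum_congr rfl fun S _ => clusterPopping_outputLaw S, ← resampleExp_sum,
    resampleExp_congr (g := fun _ => 1), resampleExp_const]
  intro T hT
  rw [← popLimit_sum, ← popLimit_one_eq_one (p := p) hA (S := ∅ \ A ∪ T) (by simpa using hT)]
  congr 1
  ext S
  rw [Finset.sum_eq_single S]
  · simp [indic]
  · intro S' _ hne
    simp [indic, hne.symm]
  · simp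

/-! ### The dynamic depth-first search -/

theorem dynamicDFS_isInvariant : (dynamicDFS L r p).IsInvariant (DFSInvariant L r) := by
  constructor
  · intro c hc
    have hc' : c ∈ (dynamicDFS L r p).init.support := hc
    rw [dynamicDFS, PMF.support_pure, Set.mem_singleton_iff] at hc'
    subst hc'
    exact ⟨by simp, trivial, fun _ _ => rfl, rfl, Stage.idle (Idle.init L.verts_nodup)⟩
  · intro c c' hc hc'
    change dfsStep L r p c (Sum.inl c') ≠ 0 at hc'
    cases hc.stepEffect (p := p) with
    | halt h1 => simp [h1] at hc'
    | move c₁ h1 h2 =>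
      rw [h1, ← PMF.mem_support_iff, PMF.support_pure, Set.mem_singleton_iff] at hc'
      cases hc'
      exact h2
    | popCluster c₁ _ h1 h2 =>
      rw [h1, ← PMF.mem_support_iff, PMF.support_pure, Set.mem_singleton_iff] at hc'
      cases hc'
      exact h2
    | draw a K h1 h2 =>
      rw [h1, ← PMF.mem_support_iff, PMF.mem_support_map_iff] at hc'
      obtain ⟨R', h3, h4⟩ := hc'
      obtain ⟨T, hT, rfl⟩ := mem_support_resample h3
      cases h4
      exact h2 T hT

theorem AdjacencyList.toFinset_verts (L : AdjacencyList A) : L.verts.toFinset = univ := by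
  ext v
  simp [L.mem_verts]

theorem dynamicDFS_init_expect_pendingExp (f : Finset (V × V) → ℝ≥0∞) :
    (dynamicDFS L r p).init.expect (pendingExp A p f) = resampleExp p A f ∅ := by
  rw [dynamicDFS_init_expect, pendingExp]
  simp only [pendingArcs, L.toFinset_verts]
  congr 1
  simp [outArcs]

/-- Only detecting a cluster makes new arcs pending, and this is absorbed by the one-pop equation
`popLimit_eq_resampleExp`. -/
theorem dynamicDFS_expect_step {c : DFSState V} (hc : DFSInvariant L r c) (b : Finset (V × V)) :
    ((dynamicDFS L r p).step c).expect
      (RandomLoop.withOutput (pendingExp A p (popLimit A r p fun S => indic (S = b))) b) =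
        pendingExp A p (popLimit A r p fun S => indic (S = b)) c := by
  change (dfsStep L r p c).expect _ = _
  cases hc.stepEffect (p := p) with
  | halt h1 h2 h3 =>
    rw [h1, PMF.expect_pure, pendingExp, h3, resampleExp_empty,
      popLimit_of_forall_not (rootConnected_iff.1 h2)]
    rfl
  | move c' h1 _ h3 h4 =>
    rw [h1, PMF.expect_pure, pendingExp, ← h3, ← h4]
    rfl
  | popCluster c' C h1 _ h3 h4 h5 h6 =>
    rw [h1, PMF.expect_pure, pendingExp, h5, resampleExp_empty, popLimit_eq_resampleExp h4, ← h3,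
      ← h6]
    rfl
  | draw a K h1 _ h3 h4 =>
    rw [h1, PMF.expect_map, expect_resample]
    exact pendingExp_draw _ h3 h4

/-- The drift bound is applied to the potential plus the mean cost of future pops: detecting a
cluster raises the potential by at most its cost less one, and the future cost falls by exactly that
cost. -/
theorem dynamicDFS_expectedSteps_le (hA : RootConnected r A) :
    (dynamicDFS L r p).expectedSteps ≤
      potential L (fun _ => none) [] [DFSTask.init L.verts, DFSTask.setRoot, DFSTask.main L.verts] +
        resampleExp p A (popLimitCost A r p fun C => clusterCost L C) ∅ := by
  set κ : Finset V → ℝ≥0∞ := fun C => clusterCost L C with hκ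
  refine (RandomLoop.expectedSteps_le dynamicDFS_isInvariant
    (fun c => potential L c.index c.stack c.tasks + pendingExp A p (popLimitCost A r p κ) c)
    fun c hc => ?_).trans_eq ?_
  · change 1 + (dfsStep L r p c).expect _ ≤ _
    cases hc.stepEffect (p := p) with
    | halt h1 h2 h3 h4 =>
      rw [h1, PMF.expect_pure, Sum.elim_inr, add_zero]
      refine le_trans ?_ le_self_add
      exact_mod_cast h4
    | move c' h1 _ h3 h4 h5 =>
      rw [h1, PMF.expect_pure, Sum.elim_inl, pendingExp, pendingExp, h3, h4, ← add_assoc]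
      gcongr
      rw [add_comm]
      exact_mod_cast h5
    | popCluster c' C h1 _ h3 h4 h5 h6 h7 =>
      rw [h1, PMF.expect_pure, Sum.elim_inl, pendingExp, pendingExp, h3, h5, h6,
        resampleExp_empty, popLimitCost_eq_resampleExp h4, popLimit_one_eq_one hA hc.subset,
        mul_one, add_comm (resampleExp _ _ _ _), ← add_assoc, ← add_assoc]
      refine add_le_add ?_ le_rfl
      rw [add_comm, hκ]
      beta_reduce
      exact_mod_cast h7
    | draw a K h1 _ h3 h4 h5 =>
      rw [h1, PMF.expect_map, expect_resample]
      simp only [Sum.elim_inl]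
      rw [resampleExp_add, resampleExp_const, pendingExp_draw _ h3 h4, ← add_assoc]
      gcongr
      rw [add_comm]
      exact_mod_cast h5
  · rw [PMF.expect_add, dynamicDFS_init_expect_pendingExp, dynamicDFS_init_expect]

theorem dynamicDFS_outputLaw (b : Finset (V × V)) :
    (dynamicDFS L r p).outputLaw b =
      resampleExp p A (popLimit A r p fun S => indic (S = b)) ∅ := by
  rw [← dynamicDFS_init_expect_pendingExp (L := L) (r := r)]
  by_cases hA : RootConnected r A
  · refine RandomLoop.outputLaw_eq dynamicDFS_isInvariant _ b
      (fun c hc => dynamicDFS_expect_step hc b) (fun c _ => ?_) ?_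
    · refine (resampleExp_mono (g := fun _ => 1) fun T _ => ?_).trans_eq (resampleExp_const _ _ _)
      exact (popLimit_mono (fun S => indic_le_one _) _).trans (popLimit_one_le_one _)
    · refine ne_top_of_le_ne_top ?_ (dynamicDFS_expectedSteps_le hA)
      exact ENNReal.add_ne_top.2 ⟨ENNReal.natCast_ne_top _,
        resampleExp_popLimitCost_ne_top hA fun _ => ENNReal.natCast_ne_top _⟩
  · have h1 := RandomLoop.outputLaw_le (dynamicDFS_isInvariant (L := L) (r := r) (p := p)) _ b
      fun c hc => dynamicDFS_expect_step hc b
    rw [dynamicDFS_init_expect_pendingExp, resampleExp_popLimit_eq_zero hA] at h1 ⊢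
    exact le_antisymm h1 zero_le

/-! ### The running time on symmetric graphs -/

theorem card_eq_sum_length_out (L : AdjacencyList A) : A.card = ∑ w, (L.out w).length := by
  rw [← card_outArcs L]
  simp [outArcs]

theorem card_le_card_arcs_add_one (L : AdjacencyList A) (h : RootConnected r A) :
    Fintype.card V ≤ A.card + 1 := by
  rw [card_eq_sum_length_out L, ← Finset.card_univ, ← Finset.card_erase_add_one (mem_univ r),
    ← Finset.add_sum_erase univ _ (mem_univ r), Finset.card_eq_sum_ones]
  have : ∑ w ∈ univ.erase r, 1 ≤ ∑ w ∈ univ.erase r, (L.out w).length :=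
    Finset.sum_le_sum fun w hw => one_le_length_out L h (Finset.ne_of_mem_erase hw)
  omega

/-- The initial potential is `6 * n + 3 * m + 4`; with `n ≤ m + 1` and `1 ≤ m` it is at most `19 *
m`. -/
theorem potential_init_le (L : AdjacencyList A) (h : RootConnected r A) (hA : A.Nonempty) :
    potential L (fun _ => none) []
      [DFSTask.init L.verts, DFSTask.setRoot, DFSTask.main L.verts] ≤ 19 * A.card := by
  have h1 := card_le_card_arcs_add_one L h
  have h2 := hA.card_pos
  have h3 : L.verts.length = Fintype.card V := by
    rw [← List.toFinset_card_of_nodup L.verts_nodup, L.toFinset_verts, Finset.card_univ]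
  have h4 : (L.verts.map fun v => 2 + (L.out v).length).sum = 2 * Fintype.card V + A.card := by
    rw [← List.sum_toFinset _ L.verts_nodup, L.toFinset_verts, Finset.sum_add_distrib,
      ← card_eq_sum_length_out L]
    simp [mul_comm]
  have h5 : ∑ v, (3 + 2 * (L.out v).length) = 3 * Fintype.card V + 2 * A.card := by
    rw [Finset.sum_add_distrib, ← Finset.mul_sum, ← card_eq_sum_length_out L]
    simp [mul_comm]
  simp only [potential, Finset.filter_true, List.map_cons, List.map_nil, List.sum_cons,
    List.sum_nil, DFSTask.cost, topCost, h3, h4, h5]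
  omega

theorem resampleExp_popLimitCost_clusterCost_le {ρ : ℝ≥0∞}
    (hconn : (SimpleGraph.fromRel fun u v => (u, v) ∈ A).Connected)
    (hsymm : ∀ u v, (u, v) ∈ A → (v, u) ∈ A ∧ p (v, u) = p (u, v))
    (hρ : ∀ a ∈ A, ENNReal.ofReal (p a : ℝ) ≤ ρ * ENNReal.ofReal (1 - (p a : ℝ))) :
    resampleExp p A (popLimitCost A r p fun C => clusterCost L C) ∅ ≤
      8 * (ρ * A.card * Fintype.card V) := by
  have hA : RootConnected r A := rootConnected_of_connected hconn (fun u v h => (hsymm u v h).1) r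
  rw [← ENNReal.mul_le_mul_iff_right (resampleExp_rootConnected_ne_zero (p := p) hA)
    (ne_top_of_le_ne_top ENNReal.one_ne_top (resampleExp_indic_le_one _ _ _))]
  refine (resampleExp_popLimitCost_le _).trans ?_
  calc _ ≤ ∑ C, 8 * (((outArcs A C).card : ℝ≥0∞) *
        resampleExp p A (fun S => indic (IsUniqueCluster r S C)) ∅) := by
        refine Finset.sum_le_sum fun C _ => ?_
        by_cases hr : r ∈ C
        · have h0 : resampleExp p A (fun S => indic (IsUniqueCluster r S C)) ∅ = 0 := by
            rw [resampleExp_congr (g := fun _ => 0), resampleExp_const]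
            exact fun T _ => indic_of_false fun h => h.1.1.2.1 hr
          rw [h0, mul_zero]
          exact zero_le
        · rw [← mul_assoc]
          gcongr
          exact_mod_cast clusterCost_le L hA hr
    _ ≤ _ := by
        rw [← Finset.mul_sum, mul_left_comm, mul_comm (resampleExp _ _ _ _)]
        gcongr
        exact sum_card_outArcs_mul_le hconn hsymm hρ

end Assembly

theorem theorem3p5 :
    (∀ (V : Type*) [Fintype V] [DecidableEq V] (A : Finset (V × V)) (L : AdjacencyList A) (r : V)
        (p : V × V → Set.Ioo (0 : ℝ) 1),
      (dynamicDFS L r p).outputLaw = (clusterPopping A r p).outputLaw ∧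
      (RootConnected r A → ∑' S, (clusterPopping A r p).outputLaw S = 1)) ∧
    ∃ K : ℝ, 0 < K ∧
      ∀ (V : Type*) [Fintype V] [DecidableEq V] (A : Finset (V × V)) (L : AdjacencyList A) (r : V)
        (p : V × V → Set.Ioo (0 : ℝ) 1) (hA : A.Nonempty),
      (SimpleGraph.fromRel fun u v => (u, v) ∈ A).Connected →
      (∀ u v, (u, v) ∈ A → (v, u) ∈ A ∧ p (v, u) = p (u, v)) →
      ∀ pmax : ℝ, pmax = A.sup' hA (fun a => (p a : ℝ)) →
      (dynamicDFS L r p).expectedSteps ≤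
        ENNReal.ofReal (K * ((A.card : ℝ) +
          pmax * (A.card : ℝ) * (Fintype.card V : ℝ) / (1 - pmax))) := by
  -- `19` comes from the initial potential and also covers the factor `8` of the cluster costs.
  refine ⟨fun V _ _ A L r p => ⟨?_, clusterPopping_tsum_outputLaw⟩, 19, by norm_num, ?_⟩
  · ext b
    rw [dynamicDFS_outputLaw, clusterPopping_outputLaw]
  · intro V _ _ A L r p hA hconn hsymm pmax hpmax
    have hroot : RootConnected r A :=
      rootConnected_of_connected hconn (fun u v h => (hsymm u v h).1) r
    have hle : ∀ a ∈ A, (p a : ℝ) ≤ pmax := fun a ha =>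
      hpmax ▸ Finset.le_sup' (fun a => (p a : ℝ)) ha
    obtain ⟨a₀, -, ha₀⟩ := Finset.exists_mem_eq_sup' hA (fun a => (p a : ℝ))
    have hp0 : 0 < pmax := by rw [hpmax, ha₀]; exact (p a₀).2.1
    have hp1 : 0 < 1 - pmax := by rw [hpmax, ha₀]; exact sub_pos.2 (p a₀).2.2
    have hodds : 0 ≤ pmax / (1 - pmax) := by positivity
    -- The odds of failure increase with the failure probability, so those of `pmax` bound them all.
    have hρ : ∀ a ∈ A, ENNReal.ofReal (p a : ℝ) ≤
        ENNReal.ofReal (pmax / (1 - pmax)) * ENNReal.ofReal (1 - (p a : ℝ)) := by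
      intro a ha
      rw [← ENNReal.ofReal_mul hodds]
      refine ENNReal.ofReal_le_ofReal ?_
      rw [div_mul_eq_mul_div, le_div_iff₀ hp1]
      nlinarith [hle a ha]
    calc (dynamicDFS L r p).expectedSteps ≤ _ := dynamicDFS_expectedSteps_le hroot
      _ ≤ ((19 * A.card : ℕ) : ℝ≥0∞) +
          8 * (ENNReal.ofReal (pmax / (1 - pmax)) * A.card * Fintype.card V) :=
        add_le_add (by exact_mod_cast potential_init_le L hroot hA)
          (resampleExp_popLimitCost_clusterCost_le hconn hsymm hρ)
      _ = ENNReal.ofReal (19 * A.card + 8 * (pmax / (1 - pmax) * A.card * Fintype.card V)) := by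
        rw [ENNReal.ofReal_add (by positivity) (by positivity), ENNReal.ofReal_mul (by norm_num),
          ENNReal.ofReal_mul (by norm_num), ENNReal.ofReal_mul (by positivity),
          ENNReal.ofReal_mul hodds]
        simp
      _ ≤ _ := by
        refine ENNReal.ofReal_le_ofReal ?_
        have h1 : pmax * (A.card : ℝ) * (Fintype.card V : ℝ) / (1 - pmax) =
            pmax / (1 - pmax) * A.card * Fintype.card V := by ring
        have h2 : 0 ≤ pmax / (1 - pmax) * A.card * Fintype.card V := by positivity
        rw [h1]
        linarith
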